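/- Fix real parameters $(\beta,\gamma,\lambda)$ that are anti-ferromagnetic: $0\le\beta\le\gamma$, $\gamma>0$, $\beta\gamma<1$, $\lambda>0$. For a finite simple graph $G=(V,E)$, a configuration $\sigma:V\to\{0,1\}$ has weight $w(\sigma)=\prod_{\{u,v\}\in E}A_{\sigma(u),\sigma(v)}\prod_{v\in V}b_{\sigma(v)}$, where $A=\begin{bmatrix}\beta&1\\1&\gamma\end{bmatrix}$ and $(b_0,b_1)=(\lambda,1)$, and the Gibbs measure gives $\sigma$ the probability $w(\sigma)/\sum_{\sigma'}w(\sigma')$. For $\Lambda\subseteq V$ and $\sigma_\Lambda\in\{0,1\}^\Lambda$ of positive probability, let $p_v^{\sigma_\Lambda}$ be the probability that $v$ has state $0$, conditioned on the configuration on $\Lambda$ being $\sigma_\Lambda$. Let $\Delta\ge 2$ be a finite integer or $\Delta=\infty$. The system has strong spatial mixing on the (finite) graphs of maximum degree at most $\Delta$ if there are constants $C,\alpha>0$ such that for every finite simple graph $G=(V,E)$ of maximum degree at most $\Delta$ (every finite simple graph if $\Delta=\infty$), every $v\in V$, every $\Lambda\subseteq V$, and all $\sigma_\Lambda,\tau_\Lambda\in\{0,1\}^\Lambda$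 of positive probability, $$|p_v^{\sigma_\Lambda}-p_v^{\tau_\Lambda}|\le C\exp(-\alpha\,\mathrm{dist}(v,S)),$$ where $S\subseteq\Lambda$ is the set on which $\sigma_\Lambda$ and $\tau_\Lambda$ differ (the right-hand side is $0$ if no vertex of $S$ is reachable from $v$). For an integer $d\ge 1$ let $f_d(x)=\lambda\left(\frac{\beta x+1}{x+\gamma}\right)^d$ and let $\hat x_d$ be its unique positive fixed point. The system is said to exhibit uniqueness on the infinite $(d+1)$-regular tree if $|f_d'(\hat x_d)|<1$. Theorem. The system has strong spatial mixing on the graphs of maximum degree at most $\Delta$ if and only if it exhibits uniqueness on the infinite regular trees of degree up to $\Delta$, that is, $|f_d'(\hat x_d)|<1$ for all integers $1\le d<\Delta$. -/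

import Mathlib

noncomputable section

namespace TwoSpin

/-- `(β, γ, lam)` is the parameter triple of an anti-ferromagnetic two-state spin system. -/
structure AntiFerromagnetic (β γ lam : ℝ) : Prop where
  beta_nonneg : 0 ≤ β
  beta_le_gamma : β ≤ γ
  gamma_pos : 0 < γ
  beta_mul_gamma_lt_one : β * γ < 1
  lam_pos : 0 < lam

/-- Edge interaction matrix; state `0` is "blue" and state `1` is "green". -/
def interaction (β γ : ℝ) : Matrix (Fin 2) (Fin 2) ℝ := !![β, 1; 1, γ]

/-- Vertex contributions. -/
def field (lam : ℝ) : Fin 2 → ℝ := ![lam, 1]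

theorem interaction_symm (β γ : ℝ) (i j : Fin 2) :
    interaction β γ i j = interaction β γ j i := by
  fin_cases i <;> fin_cases j <;> rfl

/-- The event that the configuration agrees with `σΛ` on `Λ`. -/
def agrees {V : Type} {Λ : Set V} (σΛ : Λ → Fin 2) : Set (V → Fin 2) :=
  {σ | ∀ u : Λ, σ u = σΛ u}

section Gibbs

variable {V : Type} [Fintype V]

/-- The contribution of an (unordered) edge to the weight of the configuration `σ`. -/
def edgeWeight (β γ : ℝ) (σ : V → Fin 2) : Sym2 V → ℝ :=
  Sym2.lift ⟨fun u v => interaction β γ (σ u) (σ v),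
    fun u v => interaction_symm β γ (σ u) (σ v)⟩

open Classical in
/-- The weight of a configuration. -/
def weight (β γ lam : ℝ) (G : SimpleGraph V) (σ : V → Fin 2) : ℝ :=
  (∏ e ∈ G.edgeFinset, edgeWeight β γ σ e) * ∏ v, field lam (σ v)

open Classical in
/-- The partition function. -/
def partitionFunction (β γ lam : ℝ) (G : SimpleGraph V) : ℝ :=
  ∑ σ : V → Fin 2, weight β γ lam G σ

open Classical in
/-- The probability of the event `A` under the Gibbs measure. -/
def gibbsProb (β γ lam : ℝ) (G : SimpleGraph V) (A : Set (V → Fin 2)) : ℝ :=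
  ∑ σ : V → Fin 2 with σ ∈ A, weight β γ lam G σ / partitionFunction β γ lam G

/-- The partial configuration `σΛ` has positive probability, so that one can condition on it. -/
def Feasible (β γ lam : ℝ) (G : SimpleGraph V) {Λ : Set V} (σΛ : Λ → Fin 2) : Prop :=
  0 < gibbsProb β γ lam G (agrees σΛ)

/-- The probability that `v` is blue, conditioned on the configuration of `Λ` being `σΛ`. -/
def marginal (β γ lam : ℝ) (G : SimpleGraph V) {Λ : Set V} (σΛ : Λ → Fin 2) (v : V) : ℝ :=
  gibbsProb β γ lam G ({σ | σ v = 0} ∩ agrees σΛ) / gibbsProb β γ lam G (agrees σΛ)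

end Gibbs

/-- The set of vertices of `Λ` at which `σΛ` and `τΛ` differ. -/
def disagreement {V : Type} {Λ : Set V} (σΛ τΛ : Λ → Fin 2) : Set V :=
  {u | ∃ h : u ∈ Λ, σΛ ⟨u, h⟩ ≠ τΛ ⟨u, h⟩}

/-- Graph distance from `v` to the set `S`; it is `⊤` when no vertex of `S` is reachable. -/
def distToSet {V : Type} (G : SimpleGraph V) (v : V) (S : Set V) : ℕ∞ :=
  ⨅ u ∈ S, G.edist v u

/-- The family of graphs of maximum degree at most `Δ`. -/
def MaxDegreeAtMost (Δ : ℕ∞) (V : Type) (G : SimpleGraph V) : Prop :=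
  ∀ v, (G.neighborSet v).encard ≤ Δ

/-- Strong spatial mixing on the finite graphs of the family `𝒢`: the constants `C` and `α` in
`C * exp (-α * dist(v, S))` are uniform over the family. The bound is stated for all natural
numbers `n ≤ dist(v, S)`: for a finite distance this is the bound at `n = dist(v, S)`, and for
the infinite distance it says that the two marginals coincide. -/
def StrongSpatialMixing (β γ lam : ℝ) (𝒢 : ∀ V : Type, SimpleGraph V → Prop) : Prop :=
  ∃ C > (0 : ℝ), ∃ α > (0 : ℝ),
    ∀ (V : Type) [Fintype V] (G : SimpleGraph V), 𝒢 V G →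
      ∀ (v : V) (Λ : Set V) (σΛ τΛ : Λ → Fin 2),
        Feasible β γ lam G σΛ → Feasible β γ lam G τΛ →
          ∀ n : ℕ, (n : ℕ∞) ≤ distToSet G v (disagreement σΛ τΛ) →
            |marginal β γ lam G σΛ v - marginal β γ lam G τΛ v| ≤ C * Real.exp (-α * n)

/-- The recursion `f_d` on the infinite `(d + 1)`-regular tree. -/
def treeRec (β γ lam : ℝ) (d : ℕ) (x : ℝ) : ℝ :=
  lam * ((β * x + 1) / (x + γ)) ^ d

/-- The positive fixed point of `f_d` exists and is unique. -/
theorem existsUnique_fixedPoint {β γ lam : ℝ} (h : AntiFerromagnetic β γ lam) (d : ℕ) :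
    ∃! x : ℝ, 0 < x ∧ treeRec β γ lam d x = x := by
  obtain ⟨h1, h2, h3, h4, h5⟩ := h
  have hb : ∀ x : ℝ, 0 ≤ x → 0 < (β * x + 1) / (x + γ) := fun x hx => by positivity
  have anti : ∀ x y : ℝ, 0 ≤ x → x ≤ y →
      treeRec β γ lam d y ≤ treeRec β γ lam d x := by
    intro x y hx hxy
    have hy := hx.trans hxy
    unfold treeRec
    have : (β * y + 1) / (y + γ) ≤ (β * x + 1) / (x + γ) := by
      rw [div_le_div_iff₀ (by positivity) (by positivity)]
      nlinarith [mul_nonneg (sub_nonneg.2 hxy) (sub_nonneg.2 h4.le)]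
    have := pow_le_pow_left₀ (hb y hy).le this d
    exact mul_le_mul_of_nonneg_left this h5.le
  have pos : ∀ x : ℝ, 0 ≤ x → 0 < treeRec β γ lam d x := fun x hx =>
    mul_pos h5 (pow_pos (hb x hx) d)
  have cont : ContinuousOn (fun x => treeRec β γ lam d x - x)
      (Set.Icc 0 (treeRec β γ lam d 0)) := by
    unfold treeRec
    refine ContinuousOn.sub (continuousOn_const.mul (ContinuousOn.pow
      (ContinuousOn.div (by fun_prop) (by fun_prop) ?_) d)) continuousOn_id
    intro x hx
    have := hx.1
    positivity
  have p0 := pos 0 le_rfl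
  have := intermediate_value_Icc' p0.le cont
  obtain ⟨x, hx, hfx⟩ := this (show (0 : ℝ) ∈ _ from
    ⟨sub_nonpos.2 (anti _ _ le_rfl p0.le), by simpa using p0.le⟩)
  have hfx' : treeRec β γ lam d x = x := sub_eq_zero.1 hfx
  refine ⟨x, ⟨hfx' ▸ pos x hx.1, hfx'⟩, ?_⟩
  rintro y ⟨hy, hfy⟩
  rcases le_total x y with hxy | hxy
  · have := anti x y hx.1 hxy
    linarith
  · have := anti y x hy.le hxy
    linarith

/-- Uniqueness on the infinite `(d + 1)`-regular tree: the positive fixed point `x` of `f_d`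
satisfies `|f_d'(x)| < 1`. -/
def UniqueOnRegularTree (β γ lam : ℝ) (d : ℕ) : Prop :=
  ∃ x : ℝ, (0 < x ∧ treeRec β γ lam d x = x) ∧ |deriv (treeRec β γ lam d) x| < 1

/-- Uniqueness on all infinite regular trees of degree up to `Δ`. -/
def UniqueUpTo (β γ lam : ℝ) (Δ : ℕ∞) : Prop :=
  ∀ d : ℕ, 1 ≤ d → (d : ℕ∞) < Δ → UniqueOnRegularTree β γ lam d

end TwoSpin

end

/-!
The argument works with the messages `y = (β x + 1) / (x + γ)` that a vertex sends to its parent,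
where `x` is the ratio of the weights of the states `0` and `1` at the vertex. On a tree, a vertex
with children messages `y i` has ratio `λ ∏ y i`, and a pinned child sends the constant message
`β` or `1 / γ`.

Uniqueness implies mixing. Measured in a suitable metric on messages (`potential`), one step of
the recursion with `d` children contracts by a factor that, by concavity in `log y`
(`TreeContraction.sum_sqrt_potential_sq_mul_le`), is largest when all messages are equal. For
equal messages, the statement that the factor is less than one says that a positive combination of
exponentials in `t = log y` is positive. At its minimiser this follows from the uniqueness
condition `|f_d'| < 1` at the fixed point (`critical_bound`, `rate_lt_of_unique`). Compactness
makes the factor uniform in the messages; it is uniform in `d` as well, because for unbounded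
degrees uniqueness forces `γ > 1`, which makes the factors tend to zero
(`exists_uniform_treeContraction`). The metric itself is never integrated: that two messages are
at distance at most `c` is expressed by the existence of a path of bounded speed (`Close`), and
paths are pushed through the recursion.

On a general graph, deleting a vertex `v` and telescoping over its neighbours expresses the ratio
at `v` by the ratios at the neighbours in the graph without `v`, where some other neighbours of
`v` have received an extra pinned neighbour (`exists_ratio_eq_prod`; unfolding this recursion
gives the tree of self-avoiding walks). Such systems are described by a set `W` of free vertices
and the numbers `N u s` of neighbours of `u` pinned to `s`. The total number of neighbours of a
non-root vertex stays below `Δ`, so the contraction applies at each step, and two boundary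
conditions that agree up to distance `n` give messages at distance `O(κ ^ n)`
(`close_ratio_of_agree`).

Mixing implies uniqueness. On the `d`-ary tree of depth `n` with all leaves pinned to one state
the ratio at the root is an iterate of `f_d` (`ratio_treeGraph`). The orbits for the two states
enclose the fixed point, so mixing makes an orbit converge to the fixed point exponentially fast
without reaching it, and this forces `|f_d'| < 1` there (`uniqueOnRegularTree_of_exponential`).
-/

namespace TwoSpin

/-! ### The recursion and its fixed point -/

/-- The message `(β x + 1) / (x + γ)` that a vertex with ratio `x` (of the weights of the states
`0` and `1`) sends to its parent. -/
noncomputable def edgeMap (β γ x : ℝ) : ℝ := (β * x + 1) / (x + γ)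

/-- The square of the speed `|(log y)'|` of a unit-speed path in the metric on messages that the
tree recursion contracts. It vanishes at the two ends of the interval `[β, 1 / γ]` of messages. -/
noncomputable def potential (β γ y : ℝ) : ℝ := (1 - γ * y) * (y - β) / y

theorem treeRec_eq (β γ lam : ℝ) (d : ℕ) (x : ℝ) :
    treeRec β γ lam d x = lam * edgeMap β γ x ^ d := rfl

section

variable {β γ lam : ℝ}

theorem edgeMap_pos (h : AntiFerromagnetic β γ lam) {x : ℝ} (hx : 0 ≤ x) :
    0 < edgeMap β γ x := by
  have h1 := h.beta_nonneg
  have h2 := h.gamma_pos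
  unfold edgeMap
  positivity

theorem edgeMap_sub (h : AntiFerromagnetic β γ lam) {x x' : ℝ} (hx : 0 ≤ x) (hx' : 0 ≤ x') :
    edgeMap β γ x - edgeMap β γ x' = -((1 - β * γ) * (x - x') / ((x + γ) * (x' + γ))) := by
  have h2 := h.gamma_pos
  have : x + γ ≠ 0 := by positivity
  have : x' + γ ≠ 0 := by positivity
  unfold edgeMap
  field_simp
  ring

theorem edgeMap_anti (h : AntiFerromagnetic β γ lam) {x x' : ℝ} (hx : 0 ≤ x) (hxx' : x ≤ x') :
    edgeMap β γ x' ≤ edgeMap β γ x := by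
  have h2 := h.gamma_pos
  have h3 := h.beta_mul_gamma_lt_one
  have := edgeMap_sub h (hx.trans hxx') hx
  have h4 : 0 ≤ (1 - β * γ) * (x' - x) / ((x' + γ) * (x + γ)) := by
    have := hx.trans hxx'
    have := sub_nonneg.2 h3.le
    have := sub_nonneg.2 hxx'
    positivity
  linarith

theorem edgeMap_mem_Icc (h : AntiFerromagnetic β γ lam) {x : ℝ} (hx : 0 ≤ x) :
    edgeMap β γ x ∈ Set.Icc β (1 / γ) := by
  have h2 := h.gamma_pos
  have h3 := h.beta_mul_gamma_lt_one
  unfold edgeMap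
  constructor
  · rw [le_div_iff₀ (by positivity)]
    linarith
  · rw [div_le_div_iff₀ (by positivity) (by positivity)]
    nlinarith

theorem hasDerivAt_edgeMap (h : AntiFerromagnetic β γ lam) {x : ℝ} (hx : 0 ≤ x) :
    HasDerivAt (edgeMap β γ) (-((1 - β * γ) / (x + γ) ^ 2)) x := by
  have h2 := h.gamma_pos
  have h0 : x + γ ≠ 0 := by positivity
  have := (((hasDerivAt_id x).const_mul β).add_const (1 : ℝ)).div
    ((hasDerivAt_id x).add_const γ) h0
  refine HasDerivAt.congr_deriv (f := edgeMap β γ) this ?_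
  simp only [id]
  field_simp
  ring

theorem deriv_treeRec_of_fixed (h : AntiFerromagnetic β γ lam) {d : ℕ} (hd : 1 ≤ d) {x : ℝ}
    (hx : 0 < x) (hfix : treeRec β γ lam d x = x) :
    deriv (treeRec β γ lam d) x =
      -(d * (1 - β * γ) * x / ((β * x + 1) * (x + γ))) := by
  have h1 := h.beta_nonneg
  have h2 := h.gamma_pos
  obtain ⟨k, rfl⟩ : ∃ k, d = k + 1 := ⟨d - 1, by omega⟩
  have hd := ((hasDerivAt_edgeMap h hx.le).pow (k + 1)).const_mul lam
  have : deriv (treeRec β γ lam (k + 1)) x = _ := HasDerivAt.deriv hd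
  rw [this]
  have hy := edgeMap_pos h hx.le
  rw [treeRec_eq] at hfix
  have e : lam * edgeMap β γ x ^ k = x * (x + γ) / (β * x + 1) := by
    rw [eq_div_iff (by positivity)]
    have : edgeMap β γ x * (x + γ) = β * x + 1 := by
      unfold edgeMap; field_simp
    rw [← this]
    rw [pow_succ] at hfix
    linear_combination (x + γ) * hfix
  simp only [Nat.add_sub_cancel]
  rw [show lam * (((k + 1 : ℕ) : ℝ) * edgeMap β γ x ^ k * -((1 - β * γ) / (x + γ) ^ 2)) =
    (lam * edgeMap β γ x ^ k) * (((k + 1 : ℕ) : ℝ) * -((1 - β * γ) / (x + γ) ^ 2)) by ring, e]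
  field_simp

/-- The algebra behind the contraction: `(x, y)` is a critical point of the amortized decay rate
and `(x₀, y₀)` the fixed point of the recursion, which lies on the right side of it. In terms of
`v = γ y - β / y`, the quantities `γ y + β / y` and `β x + γ / x` at the critical point are
`√(v ^ 2 + 4 β γ)` and `√(D ^ 2 v ^ 2 + 4 β γ)`, so that it suffices to bound `v ^ 2` below by its
value at the fixed point. -/
theorem critical_bound {β γ D x y x₀ y₀ : ℝ} (hβ : 0 ≤ β) (hγ : 0 < γ) (hβγ : β * γ < 1)
    (hD : 0 < D) (hx : 0 < x) (hy : 0 < y) (hx₀ : 0 < x₀) (hy₀ : y₀ = edgeMap β γ x₀)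
    (hmono : y ≤ y₀ → x ≤ x₀) (hmono' : y₀ ≤ y → x₀ ≤ x)
    (hcrit : β * x - γ / x + D * (γ * y - β / y) = 0)
    (huniq : D * (1 - β * γ) * x₀ < (β * x₀ + 1) * (x₀ + γ)) :
    0 < 1 + β * γ + (β * x + γ / x) - D ^ 2 * (1 + β * γ - (γ * y + β / y)) := by
  have hy₀p : 0 < y₀ := by rw [hy₀]; unfold edgeMap; positivity
  set U := 1 + β * γ + (β * x₀ + γ / x₀) with hU
  set m := γ / x₀ - β * x₀ with hm
  set v := γ * y - β / y with hv
  set v₀ := γ * y₀ - β / y₀ with hv₀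
  have hUpos : 0 < U := by positivity
  have e1 : v₀ * U = (1 - β * γ) * m := by
    rw [hv₀, hU, hm, hy₀]; unfold edgeMap; field_simp; ring
  have e2 : (1 + β * γ - (γ * y₀ + β / y₀)) * U = (1 - β * γ) ^ 2 := by
    rw [hU, hy₀]; unfold edgeMap; field_simp; ring
  have hDU : D * (1 - β * γ) < U := by
    have : U * x₀ = (β * x₀ + 1) * (x₀ + γ) := by rw [hU]; field_simp; ring
    rw [← this] at huniq
    exact lt_of_mul_lt_mul_right huniq hx₀.le
  have hq : 0 < 1 - β * γ := by linarith
  -- the ratio `ρ` is the derivative of the recursion at its fixed point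
  set ρ := D * (1 - β * γ) / U with hρ
  have hρ0 : 0 ≤ ρ := by positivity
  have hρ1 : ρ < 1 := by rw [hρ, div_lt_one hUpos]; exact hDU
  have e3 : D * v₀ = ρ * m := by
    rw [hρ, div_mul_eq_mul_div, eq_div_iff hUpos.ne']
    linear_combination D * e1
  have vmono : ∀ a b : ℝ, 0 < a → a ≤ b → γ * a - β / a ≤ γ * b - β / b := by
    intro a b ha hab
    have : β / b ≤ β / a := by gcongr
    have : γ * a ≤ γ * b := by gcongr
    linarith
  have zmono : ∀ a b : ℝ, 0 < a → a ≤ b → γ / b - β * b ≤ γ / a - β * a := by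
    intro a b ha hab
    have : γ / b ≤ γ / a := by gcongr
    have : β * a ≤ β * b := by gcongr
    linarith
  have hvv : v₀ ^ 2 ≤ v ^ 2 := by
    -- `v` and `v₀` have the same sign, and `v` is further away from `0`
    rcases le_total 0 m with hm0 | hm0
    · have hv0 : 0 ≤ v₀ := le_of_mul_le_mul_right
        (by rw [zero_mul, e1]; exact mul_nonneg hq.le hm0) hUpos
      have : v₀ ≤ v := by
        rcases le_total y₀ y with hle | hle
        · exact vmono _ _ hy₀p hle
        · have h1 := zmono _ _ hx (hmono hle)
          have h2 : ρ * m ≤ 1 * m := mul_le_mul_of_nonneg_right hρ1.le hm0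
          exact le_of_mul_le_mul_left (by linarith : D * v₀ ≤ D * v) hD
      exact pow_le_pow_left₀ hv0 this 2
    · have hv0 : v₀ ≤ 0 := le_of_mul_le_mul_right
        (by rw [zero_mul, e1]; exact mul_nonpos_of_nonneg_of_nonpos hq.le hm0) hUpos
      have : v ≤ v₀ := by
        rcases le_total y y₀ with hle | hle
        · exact vmono _ _ hy hle
        · have h1 := zmono _ _ hx₀ (hmono' hle)
          have h2 : 1 * m ≤ ρ * m := mul_le_mul_of_nonpos_right hρ1.le hm0
          exact le_of_mul_le_mul_left (by linarith : D * v ≤ D * v₀) hD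
      rw [← neg_sq v₀, ← neg_sq v]
      exact pow_le_pow_left₀ (neg_nonneg.2 hv0) (neg_le_neg this) 2
  have w1 : (γ * y + β / y) ^ 2 = v ^ 2 + 4 * (β * γ) := by rw [hv]; field_simp; ring
  have w2 : (γ * y₀ + β / y₀) ^ 2 = v₀ ^ 2 + 4 * (β * γ) := by rw [hv₀]; field_simp; ring
  have hw : γ * y₀ + β / y₀ ≤ γ * y + β / y :=
    le_of_sq_le_sq (by linarith) (by positivity)
  have z1 : (β * x + γ / x) ^ 2 = D ^ 2 * v ^ 2 + 4 * (β * γ) := by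
    have : (β * x + γ / x) ^ 2 = (γ / x - β * x) ^ 2 + 4 * (β * γ) := by field_simp; ring
    rw [this, show γ / x - β * x = D * v by linarith]; ring
  have z2 : (β * x₀ + γ / x₀) ^ 2 = m ^ 2 + 4 * (β * γ) := by rw [hm]; field_simp; ring
  have hz : ρ ^ 2 * (β * x₀ + γ / x₀) ≤ β * x + γ / x := by
    refine le_of_sq_le_sq ?_ (by positivity)
    have a1 : D ^ 2 * v₀ ^ 2 = ρ ^ 2 * m ^ 2 := by rw [← mul_pow, e3, mul_pow]
    have a2 : D ^ 2 * v₀ ^ 2 ≤ D ^ 2 * v ^ 2 := by gcongr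
    have a3 : ρ ^ 2 ≤ 1 := pow_le_one₀ hρ0 hρ1.le
    have a5 : (ρ ^ 2) ^ 2 ≤ ρ ^ 2 := pow_le_of_le_one (sq_nonneg ρ) a3 two_ne_zero
    have a6 := mul_le_mul_of_nonneg_right a5 (sq_nonneg m)
    have a7 := mul_le_mul_of_nonneg_right (a5.trans a3) (by positivity : 0 ≤ 4 * (β * γ))
    rw [mul_pow, z2, z1]
    linarith
  have f1 : D ^ 2 * (1 + β * γ - (γ * y₀ + β / y₀)) = ρ ^ 2 * U := by
    rw [hρ, div_pow, div_mul_eq_mul_div, eq_div_iff (by positivity)]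
    linear_combination D ^ 2 * U * e2
  have f2 : D ^ 2 * (1 + β * γ - (γ * y + β / y)) ≤ D ^ 2 * (1 + β * γ - (γ * y₀ + β / y₀)) := by
    gcongr
  have f3 : ρ ^ 2 * (1 + β * γ) < 1 + β * γ := by
    exact mul_lt_of_lt_one_left (by positivity) (pow_lt_one₀ hρ0 hρ1 two_ne_zero)
  rw [f1] at f2
  rw [hU] at f2
  linarith

end

/-! ### The contraction factor under uniqueness -/

/-- The tree recursion at a vertex with `d` children contracts the metric given by `potential` by
the factor `√K`. Only equal messages `y` from all children appear here; the general case follows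
by concavity, see `TreeContraction.sum_sqrt_potential_sq_mul_le`. -/
def TreeContraction (β γ lam : ℝ) (d : ℕ) (K : ℝ) : Prop :=
  ∀ y : ℝ, 0 < y → y ≤ 1 / γ →
    (d : ℝ) ^ 2 * potential β γ y * (lam * y ^ d) ≤
      K * ((β * (lam * y ^ d) + 1) * (lam * y ^ d + γ))

section

variable {β γ lam : ℝ}

open Filter Topology

theorem TreeContraction.mono (h : AntiFerromagnetic β γ lam) {d : ℕ} {K L : ℝ}
    (hK : TreeContraction β γ lam d K) (hKL : K ≤ L) : TreeContraction β γ lam d L := by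
  intro y hy hy'
  have h1 := h.beta_nonneg
  have h2 := h.gamma_pos
  have h3 := h.lam_pos
  exact (hK y hy hy').trans (mul_le_mul_of_nonneg_right hKL (by positivity))

theorem potential_eq {y : ℝ} (hy : y ≠ 0) :
    potential β γ y = 1 + β * γ - (γ * y + β / y) := by
  unfold potential
  field_simp
  ring

theorem potential_le_one (h : AntiFerromagnetic β γ lam) {y : ℝ} (hy : 0 < y) (hy' : y ≤ 1 / γ) :
    potential β γ y ≤ 1 := by
  have h1 := h.beta_nonneg
  have h2 := h.gamma_pos
  have h3 : γ * y ≤ 1 := by rwa [le_div_iff₀ h2, mul_comm] at hy'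
  unfold potential
  rw [div_le_one hy]
  nlinarith [mul_pos h2 hy, mul_nonneg h1 (sub_nonneg.2 h3)]

/-- Under uniqueness, the amortized decay rate is less than one everywhere. In the variable
`t = log y`, the inequality says that a positive combination of exponentials is positive, and
it is checked at the minimiser. -/
theorem rate_lt_of_unique (h : AntiFerromagnetic β γ lam) {d : ℕ} (hd : 1 ≤ d)
    (hu : UniqueOnRegularTree β γ lam d) {y : ℝ} (hy : 0 < y) :
    (d : ℝ) ^ 2 * potential β γ y * (lam * y ^ d) <
      (β * (lam * y ^ d) + 1) * (lam * y ^ d + γ) := by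
  obtain ⟨x₀, ⟨hx₀, hfix⟩, hlt⟩ := hu
  rw [deriv_treeRec_of_fixed h hd hx₀ hfix, abs_neg] at hlt
  rw [treeRec_eq] at hfix
  obtain ⟨h1, h2, h3, h4, h5⟩ := h
  have hq : 0 < 1 - β * γ := by linarith
  rw [abs_of_nonneg (by positivity), div_lt_one (by positivity)] at hlt
  have hD : (1 : ℝ) ≤ d := by exact_mod_cast hd
  have hD0 : (0 : ℝ) < d := by linarith
  set D : ℝ := (d : ℝ) with hDdef
  -- the positive combination of exponentials
  set P : ℝ → ℝ := fun t => (1 - D ^ 2) * (1 + β * γ) + β * lam * Real.exp (D * t) +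
    γ / lam * Real.exp (-(D * t)) + D ^ 2 * γ * Real.exp t + D ^ 2 * β * Real.exp (-t) with hP
  have hPeq : ∀ t, P t = 1 + β * γ + (β * (lam * Real.exp t ^ d) + γ / (lam * Real.exp t ^ d)) -
      D ^ 2 * (1 + β * γ - (γ * Real.exp t + β / Real.exp t)) := by
    intro t
    rw [← Real.exp_nat_mul, ← hDdef]
    simp only [hP, Real.exp_neg]
    field_simp
    ring
  have hPder : ∀ t, HasDerivAt P (D * (β * (lam * Real.exp t ^ d) - γ / (lam * Real.exp t ^ d) +
      D * (γ * Real.exp t - β / Real.exp t))) t := by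
    intro t
    have e1 : HasDerivAt (fun t : ℝ => D * t) D t := by
      simpa using (hasDerivAt_id t).const_mul D
    have := ((((e1.exp.const_mul (β * lam)).const_add ((1 - D ^ 2) * (1 + β * γ))).add
      (e1.neg.exp.const_mul (γ / lam))).add ((Real.hasDerivAt_exp t).const_mul (D ^ 2 * γ))).add
      ((hasDerivAt_id t).neg.exp.const_mul (D ^ 2 * β))
    refine this.congr_deriv ?_
    rw [← Real.exp_nat_mul, ← hDdef]
    simp only [id, Pi.neg_apply, Real.exp_neg]
    field_simp
    ring
  have hPcont : Continuous P := continuous_iff_continuousAt.2 fun t => (hPder t).continuousAt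
  have hcoer : Tendsto P (cocompact ℝ) atTop := by
    rw [cocompact_eq_atBot_atTop, tendsto_sup]
    constructor
    · have : Tendsto (fun t => (1 - D ^ 2) * (1 + β * γ) + γ / lam * Real.exp (-(D * t)))
          atBot atTop := by
        refine tendsto_atTop_add_const_left _ _ (Tendsto.const_mul_atTop (by positivity) ?_)
        refine Real.tendsto_exp_atTop.comp (tendsto_neg_atBot_atTop.comp ?_)
        exact tendsto_id.const_mul_atBot hD0
      refine tendsto_atTop_mono (fun t => ?_) this
      rw [hP]
      have := Real.exp_pos (D * t)
      have := Real.exp_pos t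
      have := Real.exp_pos (-t)
      have a1 : 0 ≤ β * lam * Real.exp (D * t) := by positivity
      have a2 : 0 ≤ D ^ 2 * γ * Real.exp t := by positivity
      have a3 : 0 ≤ D ^ 2 * β * Real.exp (-t) := by positivity
      linarith
    · have : Tendsto (fun t => (1 - D ^ 2) * (1 + β * γ) + D ^ 2 * γ * Real.exp t)
          atTop atTop :=
        tendsto_atTop_add_const_left _ _
          (Tendsto.const_mul_atTop (by positivity) Real.tendsto_exp_atTop)
      refine tendsto_atTop_mono (fun t => ?_) this
      rw [hP]
      have a1 : 0 ≤ β * lam * Real.exp (D * t) := by positivity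
      have a2 : 0 ≤ γ / lam * Real.exp (-(D * t)) := by positivity
      have a3 : 0 ≤ D ^ 2 * β * Real.exp (-t) := by positivity
      linarith
  obtain ⟨t, ht⟩ := hPcont.exists_forall_le hcoer
  have hcrit : D * (β * (lam * Real.exp t ^ d) - γ / (lam * Real.exp t ^ d) +
      D * (γ * Real.exp t - β / Real.exp t)) = 0 := by
    rw [← (hPder t).deriv]
    exact IsLocalMin.deriv_eq_zero (Eventually.of_forall ht)
  have hpos : 0 < P t := by
    rw [hPeq]
    have hy₀ : 0 < edgeMap β γ x₀ := by unfold edgeMap; positivity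
    refine critical_bound h1 h3 h4 hD0 (by positivity) (Real.exp_pos t) hx₀ rfl ?_ ?_
      ((mul_eq_zero.1 hcrit).resolve_left hD0.ne') hlt
    · intro hle
      rw [← hfix]
      gcongr
    · intro hle
      rw [← hfix]
      gcongr
  have := hpos.trans_le (ht (Real.log y))
  rw [hPeq, Real.exp_log hy] at this
  rw [potential_eq hy.ne']
  set x := lam * y ^ d
  have hx : 0 < x := by positivity
  have e : (β * x + 1) * (x + γ) = (1 + β * γ + (β * x + γ / x)) * x := by field_simp; ring
  rw [e]
  exact mul_lt_mul_of_pos_right (by linarith) hx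

theorem exists_treeContraction_lt_one (h : AntiFerromagnetic β γ lam) {d : ℕ} (hd : 1 ≤ d)
    (hu : UniqueOnRegularTree β γ lam d) : ∃ K < 1, TreeContraction β γ lam d K := by
  have hrate := fun y hy => rate_lt_of_unique (y := y) h hd hu hy
  obtain ⟨h1, h2, h3, h4, h5⟩ := h
  obtain ⟨k, rfl⟩ : ∃ k, d = k + 1 := ⟨d - 1, by omega⟩
  set D : ℝ := ((k + 1 : ℕ) : ℝ)
  -- the rate, written so that it is continuous at `y = 0`
  set g : ℝ → ℝ := fun y => D ^ 2 * ((1 - γ * y) * (y - β)) * (lam * y ^ k) /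
    ((β * (lam * y ^ (k + 1)) + 1) * (lam * y ^ (k + 1) + γ)) with hg
  have hden : ∀ y : ℝ, 0 ≤ y →
      0 < (β * (lam * y ^ (k + 1)) + 1) * (lam * y ^ (k + 1) + γ) := by
    intro y hy; positivity
  have hcont : ContinuousOn g (Set.Icc 0 (1 / γ)) :=
    ContinuousOn.div (by fun_prop) (by fun_prop) fun y hy => (hden y hy.1).ne'
  obtain ⟨y₁, hy₁, hmax⟩ := isCompact_Icc.exists_isMaxOn
    (Set.nonempty_Icc.2 (by positivity : (0 : ℝ) ≤ 1 / γ)) hcont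
  have key : ∀ y, 0 < y → D ^ 2 * ((1 - γ * y) * (y - β)) * (lam * y ^ k) =
      D ^ 2 * potential β γ y * (lam * y ^ (k + 1)) := by
    intro y hy
    unfold potential
    field_simp
    ring
  refine ⟨g y₁, ?_, fun y hy hy' => ?_⟩
  · rw [hg]
    simp only
    rw [div_lt_one (hden _ hy₁.1)]
    rcases hy₁.1.eq_or_lt with h0 | h0
    · refine lt_of_le_of_lt ?_ (hden _ hy₁.1)
      rw [← h0]
      have : (0 : ℝ) ≤ D ^ 2 * (lam * 0 ^ k) := by positivity
      nlinarith [mul_nonneg this h1]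
    · rw [key _ h0]
      exact hrate _ h0
  · have := hmax ⟨hy.le, hy'⟩
    rw [Set.mem_ofPred_eq] at this
    rw [← key y hy, ← div_le_iff₀ (hden y hy.le)]
    exact this

theorem treeContraction_natCast_sq (h : AntiFerromagnetic β γ lam) (d : ℕ) :
    TreeContraction β γ lam d ((d : ℝ) ^ 2) := by
  intro y hy hy'
  have hp := potential_le_one h hy hy'
  obtain ⟨h1, h2, h3, h4, h5⟩ := h
  set x := lam * y ^ d
  have hx : 0 < x := by positivity
  rw [mul_assoc]
  refine mul_le_mul_of_nonneg_left ?_ (by positivity)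
  have : 0 ≤ β * x * (x + γ) := by positivity
  nlinarith

theorem eventually_treeContraction_half (h : AntiFerromagnetic β γ lam) (hγ : 1 < γ) :
    ∀ᶠ d : ℕ in atTop, TreeContraction β γ lam d (1 / 2) := by
  have hr : |1 / γ| < 1 := by
    rw [abs_of_pos (by positivity), div_lt_one (by positivity)]; exact hγ
  have ht := (tendsto_pow_const_mul_const_pow_of_abs_lt_one 2 hr).const_mul lam
  rw [mul_zero] at ht
  filter_upwards [ht.eventually (ge_mem_nhds (by norm_num : (0 : ℝ) < 1 / 2))] with d hd y hy hy'
  have hp := potential_le_one h hy hy'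
  obtain ⟨h1, h2, h3, h4, h5⟩ := h
  have hpow : lam * y ^ d ≤ lam * (1 / γ) ^ d := by gcongr
  set x := lam * y ^ d
  have hx : 0 < x := by positivity
  have e1 : (d : ℝ) ^ 2 * potential β γ y * x ≤ (d : ℝ) ^ 2 * 1 * (lam * (1 / γ) ^ d) := by
    gcongr
  have e2 : 1 ≤ (β * x + 1) * (x + γ) := by
    have : 0 ≤ β * x * (x + γ) := by positivity
    nlinarith
  linarith

/-- If uniqueness holds on regular trees of every degree, then `γ > 1`: otherwise the fixed point
`x` of `f_d` would be bounded, thus of order `1 / d` by uniqueness, but `f_d` is bounded below by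
a positive constant at such points. -/
theorem one_lt_gamma_of_uniqueUpTo_top (h : AntiFerromagnetic β γ lam)
    (hu : UniqueUpTo β γ lam ⊤) : 1 < γ := by
  by_contra! hγ
  set M := max 1 lam
  set c := (β * M + 1) * (M + γ) / (1 - β * γ) with hc
  have hq : 0 < 1 - β * γ := by linarith [h.beta_mul_gamma_lt_one]
  have hM : 1 ≤ M := le_max_left _ _
  have hM' : lam ≤ M := le_max_right _ _
  have hcpos : 0 < c := by
    have := h.beta_nonneg
    have := h.gamma_pos
    positivity
  have main : ∀ d : ℕ, 1 ≤ d → d * (lam * Real.exp (-c)) ≤ c := by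
    intro d hd
    obtain ⟨x, ⟨hx, hfix⟩, hlt⟩ := hu d hd (ENat.natCast_lt_top d)
    rw [deriv_treeRec_of_fixed h hd hx hfix, abs_neg] at hlt
    rw [treeRec_eq] at hfix
    have hanti := fun a b => edgeMap_anti (x := a) (x' := b) h
    have hepos := edgeMap_pos h hx.le
    obtain ⟨h1, h2, h3, h4, h5⟩ := h
    have hd0 : (0 : ℝ) < d := by exact_mod_cast hd
    rw [abs_of_nonneg (by positivity), div_lt_one (by positivity)] at hlt
    have hxM : x ≤ M := by
      by_contra! hxM
      have e1 : edgeMap β γ x ≤ 1 := by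
        refine (hanti 1 x zero_le_one (hM.trans hxM.le)).trans ?_
        unfold edgeMap
        rw [div_le_one (by positivity)]
        linarith
      have e2 : edgeMap β γ x ^ d ≤ 1 := pow_le_one₀ hepos.le e1
      nlinarith
    have hdx : d * x ≤ c := by
      rw [hc, le_div_iff₀ hq]
      calc d * x * (1 - β * γ) = d * (1 - β * γ) * x := by ring
        _ ≤ (β * x + 1) * (x + γ) := hlt.le
        _ ≤ (β * M + 1) * (M + γ) := by gcongr
    have hexp : Real.exp (-x) ≤ edgeMap β γ x := by
      rw [Real.exp_neg]
      unfold edgeMap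
      rw [inv_le_comm₀ (Real.exp_pos x) (by positivity), inv_div,
        div_le_iff₀ (by positivity)]
      have a1 := Real.add_one_le_exp x
      have a2 : 0 ≤ Real.exp x * (β * x) := by positivity
      linarith
    have : lam * Real.exp (-c) ≤ x := by
      rw [← hfix]
      refine mul_le_mul_of_nonneg_left ?_ h5.le
      calc Real.exp (-c) ≤ Real.exp (d * -x) := Real.exp_le_exp.2 (by linarith)
        _ = Real.exp (-x) ^ d := Real.exp_nat_mul _ _
        _ ≤ _ := by gcongr
    calc d * (lam * Real.exp (-c)) ≤ d * x := by gcongr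
      _ ≤ c := hdx
  have hpos : 0 < lam * Real.exp (-c) := mul_pos h.lam_pos (Real.exp_pos _)
  obtain ⟨d, hd⟩ := exists_nat_gt (c / (lam * Real.exp (-c)))
  have hd' := (div_lt_iff₀ hpos).1 hd
  have : 1 ≤ d := by
    have : (0 : ℝ) < d := lt_trans (by positivity) hd
    exact_mod_cast this
  linarith [main d this]

/-- Uniqueness up to `Δ` provides one contraction factor for all non-root vertices, and bounds for
the root, which may have `Δ` children. -/
theorem exists_uniform_treeContraction (h : AntiFerromagnetic β γ lam) {Δ : ℕ∞}
    (hu : UniqueUpTo β γ lam Δ) :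
    ∃ K, 0 < K ∧ K < 1 ∧ ∃ L, 0 ≤ L ∧ ∃ B, 0 ≤ B ∧
      (∀ d : ℕ, (d : ℕ∞) < Δ → TreeContraction β γ lam d K) ∧
      (∀ d : ℕ, (d : ℕ∞) ≤ Δ → TreeContraction β γ lam d L) ∧
      (∀ d : ℕ, (d : ℕ∞) ≤ Δ → lam * (1 / γ) ^ d ≤ B) := by
  have h2 := h.gamma_pos
  have h5 := h.lam_pos
  have hfin : ∀ n : ℕ, (n : ℕ∞) ≤ Δ →
      ∃ K, 0 < K ∧ K < 1 ∧ ∀ d : ℕ, d < n → TreeContraction β γ lam d K := by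
    intro n
    induction n with
    | zero => exact fun _ => ⟨1 / 2, by norm_num, by norm_num, fun d hd => absurd hd (by omega)⟩
    | succ n ih =>
      intro hn
      have hlt : (n : ℕ∞) < Δ := lt_of_lt_of_le (by exact_mod_cast n.lt_succ_self) hn
      obtain ⟨K, hK0, hK1, hK⟩ := ih hlt.le
      have : ∃ K' < 1, TreeContraction β γ lam n K' := by
        rcases Nat.eq_zero_or_pos n with rfl | hpos
        · exact ⟨0, zero_lt_one, by simpa using treeContraction_natCast_sq h 0⟩
        · exact exists_treeContraction_lt_one h hpos (hu n hpos hlt)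
      obtain ⟨K', hK'1, hK'⟩ := this
      refine ⟨max K K', lt_max_of_lt_left hK0, max_lt hK1 hK'1, fun d hd => ?_⟩
      rcases (Nat.lt_succ_iff_lt_or_eq.1 hd) with hd | rfl
      · exact (hK d hd).mono h (le_max_left _ _)
      · exact hK'.mono h (le_max_right _ _)
  rcases eq_or_ne Δ ⊤ with rfl | hΔ
  · have hγ := one_lt_gamma_of_uniqueUpTo_top h hu
    obtain ⟨n, hn⟩ := eventually_atTop.1 (eventually_treeContraction_half h hγ)
    obtain ⟨K, hK0, hK1, hK⟩ := hfin n le_top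
    have hall : ∀ d : ℕ, TreeContraction β γ lam d (max K (1 / 2)) := by
      intro d
      rcases lt_or_ge d n with hd | hd
      · exact (hK d hd).mono h (le_max_left _ _)
      · exact (hn d hd).mono h (le_max_right _ _)
    refine ⟨max K (1 / 2), lt_max_of_lt_left hK0, max_lt hK1 (by norm_num), max K (1 / 2),
      le_max_of_le_left hK0.le, lam, h5.le, fun d _ => hall d, fun d _ => hall d, fun d _ => ?_⟩
    refine mul_le_of_le_one_right h5.le (pow_le_one₀ (by positivity) ?_)
    rw [div_le_one h2]
    exact hγ.le
  · lift Δ to ℕ using hΔ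
    obtain ⟨K, hK0, hK1, hK⟩ := hfin Δ le_rfl
    refine ⟨K, hK0, hK1, (Δ : ℝ) ^ 2, by positivity, lam * (max 1 (1 / γ)) ^ Δ, by positivity,
      fun d hd => hK d (by exact_mod_cast hd), fun d hd => ?_, fun d hd => ?_⟩
    · have : d ≤ Δ := by exact_mod_cast hd
      exact (treeContraction_natCast_sq h d).mono h (by gcongr)
    · have : d ≤ Δ := by exact_mod_cast hd
      calc lam * (1 / γ) ^ d ≤ lam * (max 1 (1 / γ)) ^ d := by
            gcongr
            exact le_max_right _ _
        _ ≤ _ := by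
            gcongr
            exact le_max_left _ _

end

/-! ### The metric on messages -/

/-- The messages `a` and `b` are joined by a path of speed at most `c` in the metric given by
`potential`; for differentiable paths this is the bound `|(log y)'| ≤ c * √(potential y)`. -/
def Close (β γ c a b : ℝ) : Prop :=
  ∃ y : ℝ → ℝ, ContinuousOn y (Set.Icc 0 1) ∧ y 0 = a ∧ y 1 = b ∧
    (∀ s ∈ Set.Icc (0 : ℝ) 1, y s ∈ Set.Icc β (1 / γ)) ∧
    ∀ s ∈ Set.Ioo (0 : ℝ) 1, ∃ y', HasDerivAt y y' s ∧
      |y'| ≤ c * (y s * √(potential β γ (y s)))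

section

variable {β γ lam : ℝ}

theorem potential_nonneg (h : AntiFerromagnetic β γ lam) {y : ℝ} (hy : y ∈ Set.Icc β (1 / γ)) :
    0 ≤ potential β γ y := by
  have h1 := h.beta_nonneg
  have h2 := h.gamma_pos
  have h3 : γ * y ≤ 1 := by
    have := hy.2
    rwa [le_div_iff₀ h2, mul_comm] at this
  unfold potential
  exact div_nonneg (mul_nonneg (by linarith) (by linarith [hy.1])) (h1.trans hy.1)

theorem Close.refl (h : AntiFerromagnetic β γ lam) {c a : ℝ} (hc : 0 ≤ c)
    (ha : a ∈ Set.Icc β (1 / γ)) : Close β γ c a a := by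
  refine ⟨fun _ => a, continuousOn_const, rfl, rfl, fun _ _ => ha, fun s _ =>
    ⟨0, hasDerivAt_const _ _, ?_⟩⟩
  have : 0 ≤ a := h.beta_nonneg.trans ha.1
  rw [abs_zero]
  positivity

/-- Messages bounded away from `β` have bounded distance. The metric is singular at `1 / γ`, but
the path along which `√(1 - γ y)` is linear has bounded speed there. -/
theorem close_of_ge (h : AntiFerromagnetic β γ lam) {y₀ a b : ℝ} (hy₀ : β < y₀)
    (ha : a ∈ Set.Icc y₀ (1 / γ)) (hb : b ∈ Set.Icc y₀ (1 / γ)) :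
    Close β γ (2 / (γ * √(y₀ * (y₀ - β)))) a b := by
  obtain ⟨h1, -, h2, -, -⟩ := h
  have hone : ∀ z, z ∈ Set.Icc y₀ (1 / γ) → 0 ≤ 1 - γ * z ∧ 1 - γ * z ≤ 1 - γ * y₀ := by
    intro z hz
    have e1 : γ * z ≤ 1 := by
      have := hz.2
      rwa [le_div_iff₀ h2, mul_comm] at this
    have e2 : γ * y₀ ≤ γ * z := by gcongr; exact hz.1
    constructor <;> linarith
  set p := √(1 - γ * a) with hp
  set q := √(1 - γ * b) with hq
  have hp0 : 0 ≤ p := Real.sqrt_nonneg _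
  have hq0 : 0 ≤ q := Real.sqrt_nonneg _
  have hp2 : p ^ 2 = 1 - γ * a := Real.sq_sqrt (hone a ha).1
  have hq2 : q ^ 2 = 1 - γ * b := Real.sq_sqrt (hone b hb).1
  have hp1 : p ≤ √(1 - γ * y₀) := Real.sqrt_le_sqrt (hone a ha).2
  have hq1 : q ≤ √(1 - γ * y₀) := Real.sqrt_le_sqrt (hone b hb).2
  have hr2 : √(1 - γ * y₀) ^ 2 = 1 - γ * y₀ :=
    Real.sq_sqrt ((hone a ha).1.trans (hone a ha).2)
  have hr1 : √(1 - γ * y₀) ≤ 1 := Real.sqrt_le_one.2 (by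
    have : 0 ≤ γ * y₀ := mul_nonneg h2.le (h1.trans hy₀.le)
    linarith)
  set r := √(1 - γ * y₀)
  set l : ℝ → ℝ := fun s => (1 - s) * p + s * q with hl
  have hl0 : ∀ s ∈ Set.Icc (0 : ℝ) 1, 0 ≤ l s ∧ l s ≤ r := by
    intro s hs
    have e1 : 0 ≤ s := hs.1
    have e2 : 0 ≤ 1 - s := sub_nonneg.2 hs.2
    refine ⟨add_nonneg (mul_nonneg e2 hp0) (mul_nonneg e1 hq0), ?_⟩
    calc l s ≤ (1 - s) * r + s * r := by simp only [hl]; gcongr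
      _ = r := by ring
  have hder : ∀ s, HasDerivAt (fun s => (1 - l s ^ 2) / γ) (-(2 * l s * (q - p)) / γ) s := by
    intro s
    have e : HasDerivAt l (q - p) s := by
      have := (((hasDerivAt_id s).const_sub 1).mul_const p).add ((hasDerivAt_id s).mul_const q)
      exact this.congr_deriv (by ring)
    exact (((e.pow 2).const_sub 1).div_const γ).congr_deriv (by push_cast; ring)
  have hrange : ∀ s ∈ Set.Icc (0 : ℝ) 1, (1 - l s ^ 2) / γ ∈ Set.Icc y₀ (1 / γ) := by
    intro s hs
    obtain ⟨e1, e2⟩ := hl0 s hs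
    constructor
    · rw [le_div_iff₀ h2]
      have : l s ^ 2 ≤ r ^ 2 := by gcongr
      linarith
    · gcongr
      have := sq_nonneg (l s)
      linarith
  refine ⟨fun s => (1 - l s ^ 2) / γ, fun s _ => (hder s).continuousAt.continuousWithinAt,
    ?_, ?_, fun s hs => ⟨hy₀.le.trans (hrange s hs).1, (hrange s hs).2⟩, fun s hs =>
    ⟨_, hder s, ?_⟩⟩
  · simp only [hl]
    rw [show (1 - (0 : ℝ)) * p + 0 * q = p by ring, hp2]
    field_simp
    ring
  · simp only [hl]
    rw [show (1 - (1 : ℝ)) * p + 1 * q = q by ring, hq2]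
    field_simp
    ring
  · have hs' := Set.Ioo_subset_Icc_self hs
    obtain ⟨e1, e2⟩ := hl0 s hs'
    obtain ⟨f1, f2⟩ := hrange s hs'
    set z := (1 - l s ^ 2) / γ with hz
    have hz0 : 0 < z := (h1.trans_lt hy₀).trans_le f1
    have hy₀' : 0 < y₀ := h1.trans_lt hy₀
    have hy₀'' : 0 < y₀ - β := by linarith
    have hlz : 1 - γ * z = l s ^ 2 := by rw [hz]; field_simp; ring
    have hpot : z * √(potential β γ z) = l s * √(z * (z - β)) := by
      have : potential β γ z = (l s / z) ^ 2 * (z * (z - β)) := by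
        unfold potential
        rw [hlz]
        field_simp
      rw [this, Real.sqrt_mul (sq_nonneg _), Real.sqrt_sq (by positivity)]
      field_simp
    rw [hpot]
    have hsq : √(y₀ * (y₀ - β)) ≤ √(z * (z - β)) := by
      apply Real.sqrt_le_sqrt
      gcongr
    have hsq0 : 0 < √(y₀ * (y₀ - β)) := Real.sqrt_pos.2 (by positivity)
    rw [neg_div, abs_neg, abs_div, abs_of_pos h2, abs_mul,
      abs_of_nonneg (by positivity : 0 ≤ 2 * l s)]
    have hqp : |q - p| ≤ 1 := by
      rw [abs_le]
      constructor <;> linarith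
    calc 2 * l s * |q - p| / γ ≤ 2 * l s * 1 / γ := by gcongr
      _ = 2 / (γ * √(y₀ * (y₀ - β))) * (l s * √(y₀ * (y₀ - β))) := by field_simp
      _ ≤ _ := by gcongr

theorem potential_edgeMap (h : AntiFerromagnetic β γ lam) {x : ℝ} (hx : 0 ≤ x) :
    potential β γ (edgeMap β γ x) = (1 - β * γ) ^ 2 * x / ((β * x + 1) * (x + γ)) := by
  obtain ⟨h1, h2, h3, h4, h5⟩ := h
  have e1 : β * x + 1 ≠ 0 := by positivity
  have e2 : x + γ ≠ 0 := by positivity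
  unfold potential edgeMap
  field_simp
  ring

/-- The contraction of the recursion for arbitrary messages from the children: by the
Cauchy–Schwarz inequality and the concavity of `potential` as a function of `log y`, the worst
case is that all messages equal their geometric mean. -/
theorem TreeContraction.sum_sqrt_potential_sq_mul_le (h : AntiFerromagnetic β γ lam)
    {ι : Type*} [Fintype ι] {K : ℝ} (hK0 : 0 ≤ K)
    (hK : TreeContraction β γ lam (Fintype.card ι) K)
    {y : ι → ℝ} (hy : ∀ i, y i ∈ Set.Icc β (1 / γ)) :
    (∑ i, √(potential β γ (y i))) ^ 2 * (lam * ∏ i, y i) ≤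
      K * ((β * (lam * ∏ i, y i) + 1) * (lam * ∏ i, y i + γ)) := by
  have hpn := fun i => potential_nonneg h (hy i)
  obtain ⟨h1, h2, h3, h4, h5⟩ := h
  have hy0 : ∀ i, 0 ≤ y i := fun i => h1.trans (hy i).1
  rcases isEmpty_or_nonempty ι with he | hne
  · simp only [Finset.univ_eq_empty, Finset.sum_empty, Finset.prod_empty]
    rw [zero_pow two_ne_zero, zero_mul]
    positivity
  by_cases hz : ∃ i, y i = 0
  · obtain ⟨i, hi⟩ := hz
    rw [Finset.prod_eq_zero (Finset.mem_univ i) hi, mul_zero, mul_zero]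
    positivity
  push Not at hz
  have hpos : ∀ i, 0 < y i := fun i => lt_of_le_of_ne (hy0 i) (hz i).symm
  set d := Fintype.card ι with hd
  have hd0 : (0 : ℝ) < d := by exact_mod_cast Fintype.card_pos
  -- the geometric mean of the messages
  set t := (∑ i, Real.log (y i)) / d with ht
  set z := Real.exp t with hz'
  have hzpos : 0 < z := Real.exp_pos t
  have hprod : ∏ i, y i = z ^ d := by
    rw [hz', ← Real.exp_nat_mul, ht, mul_div_cancel₀ _ hd0.ne', Real.exp_sum]
    exact Finset.prod_congr rfl fun i _ => (Real.exp_log (hpos i)).symm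
  have hzle : z ≤ 1 / γ := by
    have : t ≤ Real.log (1 / γ) := by
      rw [ht, div_le_iff₀ hd0, mul_comm, hd, ← nsmul_eq_mul, ← Finset.card_univ]
      exact Finset.sum_le_card_nsmul _ _ _ fun i _ => Real.log_le_log (hpos i) (hy i).2
    rw [hz', ← Real.exp_log (by positivity : 0 < 1 / γ)]
    exact Real.exp_le_exp.2 this
  have hsum0 : ∑ i, (Real.log (y i) - t) = 0 := by
    rw [Finset.sum_sub_distrib, Finset.sum_const, Finset.card_univ, nsmul_eq_mul, ht]
    field_simp
    ring
  have hconc : ∑ i, potential β γ (y i) ≤ d * potential β γ z := by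
    -- the tangent at `t` of the concave function `log y ↦ potential β γ y`
    have hi : ∀ i, potential β γ (y i) ≤
        potential β γ z + (β / z - γ * z) * (Real.log (y i) - t) := by
      intro i
      rw [potential_eq (hpos i).ne', potential_eq hzpos.ne']
      have e1 : y i = z * Real.exp (Real.log (y i) - t) := by
        rw [hz', ← Real.exp_add, add_sub_cancel, Real.exp_log (hpos i)]
      have e2 : β / y i = β / z * Real.exp (-(Real.log (y i) - t)) := by
        rw [Real.exp_neg]
        conv_lhs => rw [e1]
        field_simp
      have e3 := Real.add_one_le_exp (Real.log (y i) - t)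
      have e4 := Real.add_one_le_exp (-(Real.log (y i) - t))
      have e5 := mul_le_mul_of_nonneg_left e3 (by positivity : 0 ≤ γ * z)
      have e6 := mul_le_mul_of_nonneg_left e4 (by positivity : 0 ≤ β / z)
      have e7 : γ * y i = γ * z * Real.exp (Real.log (y i) - t) := by
        conv_lhs => rw [e1]
        ring
      rw [e2, e7]
      linarith
    calc ∑ i, potential β γ (y i)
        ≤ ∑ i, (potential β γ z + (β / z - γ * z) * (Real.log (y i) - t)) :=
          Finset.sum_le_sum fun i _ => hi i
      _ = d * potential β γ z := by
          rw [Finset.sum_add_distrib, ← Finset.mul_sum, hsum0, Finset.sum_const,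
            Finset.card_univ, nsmul_eq_mul, mul_zero, add_zero]
  have hCS : (∑ i, √(potential β γ (y i))) ^ 2 ≤ d * ∑ i, potential β γ (y i) := by
    have := sq_sum_le_card_mul_sum_sq (s := Finset.univ) (f := fun i => √(potential β γ (y i)))
    rw [Finset.card_univ] at this
    refine this.trans (le_of_eq ?_)
    congr 1
    exact Finset.sum_congr rfl fun i _ => Real.sq_sqrt (hpn i)
  rw [hprod]
  refine le_trans ?_ (hK z hzpos hzle)
  refine mul_le_mul_of_nonneg_right (hCS.trans ?_) (by positivity)
  calc d * ∑ i, potential β γ (y i) ≤ d * (d * potential β γ z) := by gcongr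
    _ = _ := by ring

theorem Close.edgeMap_prod (h : AntiFerromagnetic β γ lam) {ι : Type*} [Fintype ι] {c K : ℝ}
    (hc : 0 ≤ c) (hK0 : 0 ≤ K) (hK : TreeContraction β γ lam (Fintype.card ι) K)
    {a b : ι → ℝ} (hab : ∀ i, Close β γ c (a i) (b i)) :
    Close β γ (c * √K) (edgeMap β γ (lam * ∏ i, a i)) (edgeMap β γ (lam * ∏ i, b i)) := by
  classical
  choose y hcont ha hb hmem hder using hab
  have h1 := h.beta_nonneg
  have h2 := h.gamma_pos
  have h5 := h.lam_pos
  have hy0 : ∀ i, ∀ s ∈ Set.Icc (0 : ℝ) 1, 0 ≤ y i s := fun i s hs => h1.trans (hmem i s hs).1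
  set x : ℝ → ℝ := fun s => lam * ∏ i, y i s with hx
  have hx0 : ∀ s ∈ Set.Icc (0 : ℝ) 1, 0 ≤ x s := fun s hs =>
    mul_nonneg h5.le (Finset.prod_nonneg fun i _ => hy0 i s hs)
  refine ⟨fun s => edgeMap β γ (x s), ?_, ?_, ?_, fun s hs => edgeMap_mem_Icc h (hx0 s hs), ?_⟩
  · have hxc : ContinuousOn x (Set.Icc 0 1) :=
      continuousOn_const.mul (continuousOn_finsetProd _ fun i _ => hcont i)
    intro s hs
    exact (hasDerivAt_edgeMap h (hx0 s hs)).continuousAt.comp_continuousWithinAt (hxc s hs)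
  · simp only [hx, ha]
  · simp only [hx, hb]
  · intro s hs
    have hs' := Set.Ioo_subset_Icc_self hs
    choose y' hy' hbound using fun i => hder i s hs
    have hxd : HasDerivAt x (lam * ∑ i, (∏ j ∈ Finset.univ.erase i, y j s) * y' i) s := by
      have := (HasDerivAt.fun_finsetProd (u := Finset.univ) (f := y) (f' := y') (x := s)
        fun i _ => hy' i).const_mul lam
      simpa only [smul_eq_mul] using this
    refine ⟨_, (hasDerivAt_edgeMap h (hx0 s hs')).comp s hxd, ?_⟩
    have hxs := hx0 s hs'
    have hmain := hK.sum_sqrt_potential_sq_mul_le h hK0 fun i => hmem i s hs'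
    rw [show lam * ∏ i, y i s = x s from rfl] at hmain
    set T := ∑ i, √(potential β γ (y i s)) with hT
    have hT0 : 0 ≤ T := Finset.sum_nonneg fun i _ => Real.sqrt_nonneg _
    have hq : 0 < 1 - β * γ := sub_pos.2 h.beta_mul_gamma_lt_one
    have hxbound : |lam * ∑ i, (∏ j ∈ Finset.univ.erase i, y j s) * y' i| ≤ x s * (c * T) := by
      rw [abs_mul, abs_of_pos h5, hx]
      simp only
      rw [mul_assoc, hT, Finset.mul_sum, Finset.mul_sum]
      refine mul_le_mul_of_nonneg_left ((Finset.abs_sum_le_sum_abs _ _).trans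
        (Finset.sum_le_sum fun i _ => ?_)) h5.le
      have hpn : 0 ≤ ∏ j ∈ Finset.univ.erase i, y j s :=
        Finset.prod_nonneg fun j _ => hy0 j s hs'
      rw [abs_mul, abs_of_nonneg hpn]
      refine (mul_le_mul_of_nonneg_left (hbound i) hpn).trans (le_of_eq ?_)
      rw [← Finset.mul_prod_erase Finset.univ (fun j => y j s) (Finset.mem_univ i)]
      ring
    set X := x s
    set Q := (β * X + 1) * (X + γ) with hQ
    have hQ0 : 0 < Q := by positivity
    have hroot : T * √X ≤ √K * √Q := by
      rw [← Real.sqrt_mul hK0, ← Real.sqrt_sq hT0, ← Real.sqrt_mul (sq_nonneg T)]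
      exact Real.sqrt_le_sqrt hmain
    have hXT : X * T ≤ √K * (√X * √Q) := by
      calc X * T = √X * (T * √X) := by
            rw [show √X * (T * √X) = T * (√X * √X) by ring, Real.mul_self_sqrt hxs]; ring
        _ ≤ √X * (√K * √Q) := by gcongr
        _ = _ := by ring
    have hpot : edgeMap β γ X * √(potential β γ (edgeMap β γ X)) =
        (1 - β * γ) / (X + γ) ^ 2 * (√X * √Q) := by
      rw [potential_edgeMap h hxs, Real.sqrt_div (by positivity), Real.sqrt_mul (by positivity),
        Real.sqrt_sq hq.le, ← hQ]
      have hsQ : √Q ≠ 0 := (Real.sqrt_pos.2 hQ0).ne'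
      have hQQ : √Q * √Q = (β * X + 1) * (X + γ) := Real.mul_self_sqrt hQ0.le
      have : X + γ ≠ 0 := by positivity
      unfold edgeMap
      field_simp
      rw [pow_two, hQQ]
      ring
    rw [abs_mul, abs_neg, abs_of_nonneg (by positivity), hpot]
    calc (1 - β * γ) / (X + γ) ^ 2 * |lam * ∑ i, (∏ j ∈ Finset.univ.erase i, y j s) * y' i|
        ≤ (1 - β * γ) / (X + γ) ^ 2 * (c * (X * T)) := by
          gcongr
          exact hxbound.trans (le_of_eq (by ring))
      _ ≤ (1 - β * γ) / (X + γ) ^ 2 * (c * (√K * (√X * √Q))) := by gcongr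
      _ = _ := by ring

theorem Close.abs_sub_le (h : AntiFerromagnetic β γ lam) {c a b : ℝ} (hc : 0 ≤ c)
    (hab : Close β γ c a b) : |a - b| ≤ c / γ := by
  obtain ⟨y, hcont, rfl, rfl, hmem, hder⟩ := hab
  have h2 := h.gamma_pos
  choose! y' hy' hb using hder
  obtain ⟨s, hs, hs'⟩ := exists_hasDerivAt_eq_slope y y' zero_lt_one hcont hy'
  rw [sub_zero, div_one] at hs'
  rw [abs_sub_comm, ← hs']
  refine (hb s hs).trans ?_
  obtain ⟨m1, m2⟩ := hmem s (Set.Ioo_subset_Icc_self hs)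
  have hy0 : 0 ≤ y s := h.beta_nonneg.trans m1
  rw [div_eq_mul_one_div]
  refine mul_le_mul_of_nonneg_left ?_ hc
  rcases hy0.eq_or_lt with h0 | h0
  · rw [← h0, zero_mul]; positivity
  · calc y s * √(potential β γ (y s)) ≤ y s * 1 := by
          gcongr
          exact Real.sqrt_le_one.2 (potential_le_one h h0 m2)
      _ ≤ 1 / γ := by rw [mul_one]; exact m2

end

/-! ### Free systems with pinned neighbours and the deletion of a vertex -/

/-- The contribution of a vertex in state `i` that has `N s` additional neighbours pinned to the
state `s`, for `s = 0, 1`. -/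
noncomputable def localField (β γ lam : ℝ) (N : Fin 2 → ℕ) (i : Fin 2) : ℝ :=
  field lam i * interaction β γ 0 i ^ N 0 * interaction β γ 1 i ^ N 1

section

variable {V : Type}

open Classical in
/-- The number of neighbours of `u` that lie in `B` and are pinned to `s` by `ρ`. -/
noncomputable def pinCount (G : SimpleGraph V) (B : Finset V) (ρ : V → Fin 2) :
    V → Fin 2 → ℕ :=
  fun u s => Finset.card {w ∈ B | G.Adj w u ∧ ρ w = s}

open Classical in
/-- One additional neighbour, pinned to `i`, for every vertex of `s`. -/
noncomputable def bump (s : Finset V) (i : Fin 2) : V → Fin 2 → ℕ :=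
  fun w j => if w ∈ s ∧ j = i then 1 else 0

theorem edgeWeight_mk (β γ : ℝ) (σ : V → Fin 2) (u w : V) :
    edgeWeight β γ σ s(u, w) = interaction β γ (σ u) (σ w) := rfl

theorem edgeWeight_congr (β γ : ℝ) {σ τ : V → Fin 2} {e : Sym2 V} (h : ∀ x ∈ e, σ x = τ x) :
    edgeWeight β γ σ e = edgeWeight β γ τ e := by
  induction e using Sym2.ind with
  | _ u w =>
    rw [edgeWeight_mk, edgeWeight_mk, h u (Sym2.mem_mk_left u w), h w (Sym2.mem_mk_right u w)]

open Classical in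
theorem prod_interaction_eq (β γ : ℝ) (G : SimpleGraph V) (B : Finset V) (ρ : V → Fin 2) (u : V)
    (i : Fin 2) :
    ∏ w ∈ B with G.Adj w u, interaction β γ (ρ w) i =
      interaction β γ 0 i ^ pinCount G B ρ u 0 * interaction β γ 1 i ^ pinCount G B ρ u 1 := by
  rw [← Finset.prod_filter_mul_prod_filter_not _ (fun w => ρ w = 0)]
  have h1 : ∀ w, ¬ρ w = 0 ↔ ρ w = 1 := fun w => by
    generalize ρ w = a
    fin_cases a <;> simp
  unfold pinCount
  congr 1
  · rw [Finset.filter_filter]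
    refine Finset.prod_eq_pow_card fun w hw => ?_
    rw [(Finset.mem_filter.1 hw).2.2]
  · rw [Finset.filter_filter]
    simp only [h1]
    refine Finset.prod_eq_pow_card fun w hw => ?_
    rw [(Finset.mem_filter.1 hw).2.2]

theorem bump_insert [DecidableEq V] {s : Finset V} {u : V} (hu : u ∉ s) (i : Fin 2) :
    (bump (insert u s) i : V → Fin 2 → ℕ) = bump {u} i + bump s i := by
  funext w j
  simp only [bump, Pi.add_apply, Finset.mem_insert, Finset.mem_singleton]
  by_cases hw : w = u
  · subst hw
    simp [hu]
  · simp [hw]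

theorem bump_apply_of_notMem {s : Finset V} {u : V} (hu : u ∉ s) (i : Fin 2) :
    (bump s i : V → Fin 2 → ℕ) u = 0 := by
  funext j
  simp [bump, hu]

theorem bump_apply_add_le [DecidableEq V] (s : Finset V) (i : Fin 2) (w : V) :
    bump s i w 0 + bump s i w 1 ≤ if w ∈ s then 1 else 0 := by
  unfold bump
  by_cases hw : w ∈ s <;> fin_cases i <;> simp [hw]

end

theorem localField_add (β γ lam : ℝ) (N M : Fin 2 → ℕ) (i : Fin 2) :
    localField β γ lam (N + M) i =
      localField β γ lam N i * (interaction β γ 0 i ^ M 0 * interaction β γ 1 i ^ M 1) := by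
  simp only [localField, Pi.add_apply, pow_add]
  ring

section

variable {β γ lam : ℝ}

theorem interaction_nonneg (h : AntiFerromagnetic β γ lam) (i j : Fin 2) :
    0 ≤ interaction β γ i j := by
  have h1 := h.beta_nonneg
  have h2 := h.gamma_pos.le
  fin_cases i <;> fin_cases j <;> simp [interaction, h1, h2]

theorem interaction_one_pos (h : AntiFerromagnetic β γ lam) (i : Fin 2) :
    0 < interaction β γ i 1 := by
  have h2 := h.gamma_pos
  fin_cases i <;> simp [interaction, h2]

theorem field_pos (h : AntiFerromagnetic β γ lam) (i : Fin 2) : 0 < field lam i := by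
  have h2 := h.lam_pos
  fin_cases i <;> simp [field, h2]

theorem localField_nonneg (h : AntiFerromagnetic β γ lam) (N : Fin 2 → ℕ) (i : Fin 2) :
    0 ≤ localField β γ lam N i := by
  have := interaction_nonneg h 0 i
  have := interaction_nonneg h 1 i
  have := field_pos h i
  unfold localField
  positivity

theorem localField_one_pos (h : AntiFerromagnetic β γ lam) (N : Fin 2 → ℕ) :
    0 < localField β γ lam N 1 := by
  have := interaction_one_pos h 0
  have := interaction_one_pos h 1
  have := field_pos h 1
  unfold localField
  positivity

theorem localField_div (h : AntiFerromagnetic β γ lam) (N : Fin 2 → ℕ) :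
    localField β γ lam N 0 / localField β γ lam N 1 = lam * β ^ N 0 * (1 / γ) ^ N 1 := by
  have := h.gamma_pos
  simp [localField, field, interaction]
  field_simp

theorem edgeWeight_nonneg (h : AntiFerromagnetic β γ lam) {V : Type} (σ : V → Fin 2) (e : Sym2 V) :
    0 ≤ edgeWeight β γ σ e := by
  induction e using Sym2.ind with
  | _ u w => exact interaction_nonneg h _ _

end

section

variable {V : Type} [Fintype V]

open Classical in
/-- The contribution of the edges with both ends in `W`. -/
noncomputable def innerWeight (β γ : ℝ) (G : SimpleGraph V) (W : Finset V) (σ : V → Fin 2) : ℝ :=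
  ∏ e ∈ G.edgeFinset with (∀ x ∈ e, x ∈ W), edgeWeight β γ σ e

/-- The weight of the restriction of `σ` to `W` in the system on the subgraph induced by `W`, in
which every vertex `u ∈ W` has `N u s` additional neighbours pinned to `s`. -/
noncomputable def freeWeight (β γ lam : ℝ) (G : SimpleGraph V) (W : Finset V)
    (N : V → Fin 2 → ℕ) (σ : V → Fin 2) : ℝ :=
  innerWeight β γ G W σ * ∏ u ∈ W, localField β γ lam (N u) (σ u)

open Classical in
/-- The configurations on `W`, represented by their extension by `1` to all vertices. -/
noncomputable def configs (W : Finset V) : Finset (V → Fin 2) := {σ | ∀ u, u ∉ W → σ u = 1}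

/-- The partition function of the system with weights `freeWeight`. -/
noncomputable def freeZ (β γ lam : ℝ) (G : SimpleGraph V) (W : Finset V) (N : V → Fin 2 → ℕ) : ℝ :=
  ∑ σ ∈ configs W, freeWeight β γ lam G W N σ

/-- The ratio of the weights of the states `0` and `1` at the vertex `v ∈ W`. -/
noncomputable def ratio [DecidableEq V] (β γ lam : ℝ) (G : SimpleGraph V) (W : Finset V)
    (N : V → Fin 2 → ℕ)
    (v : V) : ℝ :=
  (localField β γ lam (N v) 0 * freeZ β γ lam G (W.erase v) (N + pinCount G {v} fun _ => 0)) /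
    (localField β γ lam (N v) 1 * freeZ β γ lam G (W.erase v) (N + pinCount G {v} fun _ => 1))

theorem innerWeight_congr (β γ : ℝ) (G : SimpleGraph V) {W : Finset V} {σ τ : V → Fin 2}
    (h : ∀ x ∈ W, σ x = τ x) : innerWeight β γ G W σ = innerWeight β γ G W τ := by
  unfold innerWeight
  classical
  refine Finset.prod_congr rfl fun e he => edgeWeight_congr β γ fun x hx => h x ?_
  exact (Finset.mem_filter.1 he).2 x hx

theorem freeWeight_congr (β γ lam : ℝ) (G : SimpleGraph V) {W : Finset V}
    {N M : V → Fin 2 → ℕ} {σ τ : V → Fin 2} (hN : ∀ x ∈ W, N x = M x) (h : ∀ x ∈ W, σ x = τ x) :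
    freeWeight β γ lam G W N σ = freeWeight β γ lam G W M τ := by
  unfold freeWeight
  rw [innerWeight_congr β γ G h]
  congr 1
  exact Finset.prod_congr rfl fun x hx => by rw [hN x hx, h x hx]

theorem freeZ_congr (β γ lam : ℝ) (G : SimpleGraph V) {W : Finset V}
    {N M : V → Fin 2 → ℕ} (hN : ∀ x ∈ W, N x = M x) :
    freeZ β γ lam G W N = freeZ β γ lam G W M :=
  Finset.sum_congr rfl fun _ _ => freeWeight_congr β γ lam G hN fun _ _ => rfl

open Classical in
/-- The edges inside `W` are those outside `B`, those inside `B` and those between the two. -/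
theorem innerWeight_eq_mul [DecidableEq V] (β γ : ℝ) (G : SimpleGraph V) {W B : Finset V}
    (hB : B ⊆ W)
    (σ : V → Fin 2) :
    innerWeight β γ G W σ = innerWeight β γ G (W \ B) σ * innerWeight β γ G B σ *
      ∏ u ∈ W \ B, ∏ w ∈ B with G.Adj w u, interaction β γ (σ w) (σ u) := by
  unfold innerWeight
  rw [← Finset.prod_filter_mul_prod_filter_not _ (fun e : Sym2 V => ∀ x ∈ e, x ∉ B), mul_assoc]
  congr 1
  · refine Finset.prod_congr (Finset.ext fun e => ?_) fun _ _ => rfl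
    simp only [Finset.mem_filter, Finset.mem_sdiff]
    grind
  rw [← Finset.prod_filter_mul_prod_filter_not _ (fun e : Sym2 V => ∀ x ∈ e, x ∈ B)]
  congr 1
  · refine Finset.prod_congr (Finset.ext fun e => ?_) fun _ _ => rfl
    simp only [Finset.mem_filter]
    constructor
    · exact fun h => ⟨h.1.1.1, h.2⟩
    · rintro ⟨he, h⟩
      refine ⟨⟨⟨he, fun x hx => hB (h x hx)⟩, fun h' => ?_⟩, h⟩
      induction e using Sym2.ind with
      | _ u w => exact h' u (Sym2.mem_mk_left u w) (h u (Sym2.mem_mk_left u w))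
  rw [Finset.prod_sigma']
  symm
  refine Finset.prod_bij (fun p _ => s(p.2, p.1)) ?_ ?_ ?_ ?_
  · rintro ⟨u, w⟩ hp
    simp only [Finset.mem_sigma, Finset.mem_sdiff, Finset.mem_filter] at hp
    obtain ⟨⟨huW, huB⟩, hwB, hadj⟩ := hp
    simp only [Finset.mem_filter, SimpleGraph.mem_edgeFinset, SimpleGraph.mem_edgeSet, Sym2.mem_iff]
    refine ⟨⟨⟨hadj, ?_⟩, ?_⟩, ?_⟩
    · rintro x (rfl | rfl)
      exacts [hB hwB, huW]
    · exact fun h => h w (Or.inl rfl) hwB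
    · exact fun h => huB (h u (Or.inr rfl))
  · rintro ⟨u, w⟩ hp ⟨u', w'⟩ hp' heq
    simp only [Finset.mem_sigma, Finset.mem_sdiff, Finset.mem_filter] at hp hp'
    simp only [Sym2.eq_iff] at heq
    rcases heq with ⟨rfl, rfl⟩ | ⟨rfl, rfl⟩
    · rfl
    · exact absurd hp.2.1 hp'.1.2
  · intro e he
    induction e using Sym2.ind with
    | _ u w =>
      simp only [Finset.mem_filter, SimpleGraph.mem_edgeFinset, SimpleGraph.mem_edgeSet,
        Sym2.mem_iff, forall_eq_or_imp, forall_eq] at he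
      obtain ⟨⟨⟨hadj, huW, hwW⟩, h1⟩, h2⟩ := he
      by_cases hu : u ∈ B
      · have hw : w ∉ B := fun hw => h2 ⟨hu, hw⟩
        exact ⟨⟨w, u⟩, by simp [hwW, hu, hw, hadj], rfl⟩
      · have hw : w ∈ B := by
          by_contra hw
          exact h1 ⟨hu, hw⟩
        exact ⟨⟨u, w⟩, by simp [huW, hu, hw, hadj.symm], Sym2.eq_swap⟩
  · rintro ⟨u, w⟩ _
    rfl

open Classical in
theorem freeWeight_eq_mul [DecidableEq V] (β γ lam : ℝ) (G : SimpleGraph V) {W B : Finset V}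
    (hB : B ⊆ W)
    (N : V → Fin 2 → ℕ) {σ ρ : V → Fin 2} (hσ : ∀ w ∈ B, σ w = ρ w) :
    freeWeight β γ lam G W N σ =
      (innerWeight β γ G B ρ * ∏ w ∈ B, localField β γ lam (N w) (ρ w)) *
        freeWeight β γ lam G (W \ B) (N + pinCount G B ρ) σ := by
  unfold freeWeight
  rw [innerWeight_eq_mul β γ G hB, ← Finset.prod_sdiff hB]
  have e1 : ∏ u ∈ W \ B, localField β γ lam ((N + pinCount G B ρ) u) (σ u) =
      (∏ u ∈ W \ B, localField β γ lam (N u) (σ u)) *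
        ∏ u ∈ W \ B, ∏ w ∈ B with G.Adj w u, interaction β γ (σ w) (σ u) := by
    rw [← Finset.prod_mul_distrib]
    refine Finset.prod_congr rfl fun u _ => ?_
    rw [Pi.add_apply, localField_add, ← prod_interaction_eq]
    congr 1
    refine Finset.prod_congr rfl fun w hw => ?_
    rw [hσ w (Finset.mem_filter.1 hw).1]
  have e2 : ∏ w ∈ B, localField β γ lam (N w) (ρ w) = ∏ w ∈ B, localField β γ lam (N w) (σ w) :=
    Finset.prod_congr rfl fun w hw => by rw [hσ w hw]
  rw [e1, e2, ← innerWeight_congr β γ G hσ]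
  ring

open Classical in
/-- Pinning the vertices of `B` leaves a system on `W \ B`, up to a constant factor. -/
theorem sum_pinned_eq [DecidableEq V] (β γ lam : ℝ) (G : SimpleGraph V) {W B : Finset V}
    (hB : B ⊆ W)
    (N : V → Fin 2 → ℕ) (ρ : V → Fin 2) (p : (V → Fin 2) → Prop)
    (hp : ∀ σ τ : V → Fin 2, (∀ u ∈ W \ B, σ u = τ u) → (p σ ↔ p τ)) :
    ∑ σ ∈ configs W with (∀ w ∈ B, σ w = ρ w) ∧ p σ, freeWeight β γ lam G W N σ =
      (innerWeight β γ G B ρ * ∏ w ∈ B, localField β γ lam (N w) (ρ w)) *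
        ∑ σ ∈ configs (W \ B) with p σ, freeWeight β γ lam G (W \ B) (N + pinCount G B ρ) σ := by
  rw [Finset.mul_sum]
  have hout : ∀ (f σ : V → Fin 2), ∀ u ∈ W \ B, (if u ∈ B then f u else σ u) = σ u :=
    fun f σ u hu => if_neg (Finset.mem_sdiff.1 hu).2
  refine Finset.sum_bij' (fun σ _ u => if u ∈ B then 1 else σ u)
    (fun σ _ u => if u ∈ B then ρ u else σ u) ?_ ?_ ?_ ?_ ?_
  · intro σ hσ
    simp only [configs, Finset.mem_filter, Finset.mem_univ, true_and] at hσ ⊢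
    refine ⟨fun u hu => ?_, (hp _ _ (hout (fun _ => 1) σ)).2 hσ.2.2⟩
    split_ifs with h
    · rfl
    · exact hσ.1 u fun hW => hu (Finset.mem_sdiff.2 ⟨hW, h⟩)
  · intro σ hσ
    simp only [configs, Finset.mem_filter, Finset.mem_univ, true_and] at hσ ⊢
    refine ⟨fun u hu => ?_, fun u hu => if_pos hu, (hp _ _ (hout ρ σ)).2 hσ.2⟩
    rw [if_neg fun h => hu (hB h)]
    exact hσ.1 u fun h => hu (Finset.mem_sdiff.1 h).1
  · intro σ hσ
    have := (Finset.mem_filter.1 hσ).2.1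
    funext u
    by_cases h : u ∈ B
    · simp [h, this u h]
    · simp [h]
  · intro σ hσ
    simp only [configs, Finset.mem_filter, Finset.mem_univ, true_and] at hσ
    funext u
    by_cases h : u ∈ B
    · simp [h, hσ.1 u fun h' => (Finset.mem_sdiff.1 h').2 h]
    · simp [h]
  · intro σ hσ
    rw [freeWeight_eq_mul β γ lam G hB N (Finset.mem_filter.1 hσ).2.1]
    congr 1
    exact freeWeight_congr β γ lam G (fun _ _ => rfl) fun u hu => (hout (fun _ => 1) σ u hu).symm

theorem innerWeight_singleton (β γ : ℝ) (G : SimpleGraph V) (v : V) (σ : V → Fin 2) :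
    innerWeight β γ G {v} σ = 1 := by
  classical
  unfold innerWeight
  refine Finset.prod_eq_one fun e he => ?_
  induction e using Sym2.ind with
  | _ u w =>
    simp only [Finset.mem_filter, SimpleGraph.mem_edgeFinset, SimpleGraph.mem_edgeSet,
      Sym2.mem_iff, forall_eq_or_imp, forall_eq, Finset.mem_singleton] at he
    obtain ⟨hadj, rfl, rfl⟩ := he
    exact absurd rfl hadj.ne

open Classical in
theorem sum_configs_eq [DecidableEq V] (β γ lam : ℝ) (G : SimpleGraph V) {W : Finset V} {v : V}
    (hv : v ∈ W)
    (N : V → Fin 2 → ℕ) (i : Fin 2) :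
    ∑ σ ∈ configs W with σ v = i, freeWeight β γ lam G W N σ =
      localField β γ lam (N v) i *
        freeZ β γ lam G (W.erase v) (N + pinCount G {v} fun _ => i) := by
  have := sum_pinned_eq β γ lam G (Finset.singleton_subset_iff.2 hv) N (fun _ => i)
    (fun _ => True) fun _ _ _ => Iff.rfl
  simpa [innerWeight_singleton, Finset.sdiff_singleton_eq_erase, freeZ] using this

theorem freeZ_eq_add [DecidableEq V] (β γ lam : ℝ) (G : SimpleGraph V) {W : Finset V} {v : V}
    (hv : v ∈ W)
    (N : V → Fin 2 → ℕ) :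
    freeZ β γ lam G W N =
      localField β γ lam (N v) 0 *
        freeZ β γ lam G (W.erase v) (N + pinCount G {v} fun _ => 0) +
      localField β γ lam (N v) 1 *
        freeZ β γ lam G (W.erase v) (N + pinCount G {v} fun _ => 1) := by
  rw [← sum_configs_eq β γ lam G hv, ← sum_configs_eq β γ lam G hv, freeZ,
    ← Finset.sum_filter_add_sum_filter_not _ (fun σ : V → Fin 2 => σ v = 0)]
  congr 1
  refine Finset.sum_congr (Finset.filter_congr fun σ _ => ?_) fun _ _ => rfl
  generalize σ v = a
  fin_cases a <;> simp

section

variable {β γ lam : ℝ}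

theorem freeWeight_nonneg (h : AntiFerromagnetic β γ lam) (G : SimpleGraph V) (W : Finset V)
    (N : V → Fin 2 → ℕ) (σ : V → Fin 2) : 0 ≤ freeWeight β γ lam G W N σ :=
  mul_nonneg (Finset.prod_nonneg fun _ _ => edgeWeight_nonneg h _ _)
    (Finset.prod_nonneg fun _ _ => localField_nonneg h _ _)

theorem freeZ_pos (h : AntiFerromagnetic β γ lam) (G : SimpleGraph V) (W : Finset V)
    (N : V → Fin 2 → ℕ) : 0 < freeZ β γ lam G W N := by
  -- the configuration that is constantly `1` has positive weight even if `β = 0`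
  refine Finset.sum_pos' (fun σ _ => freeWeight_nonneg h G W N σ) ⟨fun _ => 1, ?_, ?_⟩
  · simp [configs]
  · refine mul_pos (Finset.prod_pos fun e _ => ?_)
      (Finset.prod_pos fun u _ => localField_one_pos h _)
    induction e using Sym2.ind with
    | _ u w => exact interaction_one_pos h 1

theorem ratio_nonneg [DecidableEq V] (h : AntiFerromagnetic β γ lam) (G : SimpleGraph V)
    (W : Finset V)
    (N : V → Fin 2 → ℕ) (v : V) : 0 ≤ ratio β γ lam G W N v :=
  div_nonneg (mul_nonneg (localField_nonneg h _ _) (freeZ_pos h _ _ _).le)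
    (mul_nonneg (localField_nonneg h _ _) (freeZ_pos h _ _ _).le)

/-- Attaching a neighbour of `u` pinned to `0`, compared to one pinned to `1`. -/
theorem freeZ_bump_div [DecidableEq V] (h : AntiFerromagnetic β γ lam) (G : SimpleGraph V)
    {W : Finset V} {u : V}
    (hu : u ∈ W) (N : V → Fin 2 → ℕ) :
    freeZ β γ lam G W (N + bump {u} 0) / freeZ β γ lam G W (N + bump {u} 1) =
      edgeMap β γ (ratio β γ lam G W N u) := by
  have e1 : ∀ i j : Fin 2, freeZ β γ lam G (W.erase u)
      (N + bump {u} i + pinCount G {u} fun _ => j) =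
      freeZ β γ lam G (W.erase u) (N + pinCount G {u} fun _ => j) := by
    intro i j
    refine freeZ_congr β γ lam G fun x hx => ?_
    have hx' := Finset.ne_of_mem_erase hx
    funext k
    simp [bump, hx']
  have e2 : ∀ i j : Fin 2, localField β γ lam ((N + bump {u} i) u) j =
      localField β γ lam (N u) j * interaction β γ i j := by
    intro i j
    rw [Pi.add_apply, localField_add]
    congr 1
    fin_cases i <;> simp [bump]
  rw [freeZ_eq_add β γ lam G hu, freeZ_eq_add β γ lam G hu]
  simp only [e1, e2]
  unfold ratio edgeMap
  have p0 := localField_nonneg h (N u) 0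
  have p1 := localField_one_pos h (N u)
  have q0 := freeZ_pos h G (W.erase u) (N + pinCount G {u} fun _ => 0)
  have q1 := freeZ_pos h G (W.erase u) (N + pinCount G {u} fun _ => 1)
  have hγ := h.gamma_pos
  set a := localField β γ lam (N u) 0
  set b := localField β γ lam (N u) 1
  set c := freeZ β γ lam G (W.erase u) (N + pinCount G {u} fun _ => 0)
  set d := freeZ β γ lam G (W.erase u) (N + pinCount G {u} fun _ => 1)
  have i00 : interaction β γ 0 0 = β := by simp [interaction]
  have i01 : interaction β γ 0 1 = 1 := by simp [interaction]
  have i10 : interaction β γ 1 0 = 1 := by simp [interaction]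
  have i11 : interaction β γ 1 1 = γ := by simp [interaction]
  rw [i00, i01, i10, i11]
  have : 0 < a * c + γ * (b * d) := by positivity
  have : 0 < a * 1 * c + b * γ * d := by positivity
  have : 0 < a * c / (b * d) + γ := by positivity
  field_simp

/-- Telescoping: a vertex of state `0` joined to all of `s`, compared to one of state `1`. The
comparison for two systems `N` and `N'` with the same additional pinnings `M`. -/
theorem exists_freeZ_bump_div_eq_prod [DecidableEq V] (h : AntiFerromagnetic β γ lam)
    (G : SimpleGraph V) {W : Finset V} (s : Finset V) (hs : s ⊆ W) (N N' : V → Fin 2 → ℕ) :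
    ∃ M : V → V → Fin 2 → ℕ,
      freeZ β γ lam G W (N + bump s 0) / freeZ β γ lam G W (N + bump s 1) =
        ∏ u ∈ s, edgeMap β γ (ratio β γ lam G W (N + M u) u) ∧
      freeZ β γ lam G W (N' + bump s 0) / freeZ β γ lam G W (N' + bump s 1) =
        ∏ u ∈ s, edgeMap β γ (ratio β γ lam G W (N' + M u) u) ∧
      ∀ u ∈ s, M u u = 0 ∧ ∀ w, M u w 0 + M u w 1 ≤ if w ∈ s then 1 else 0 := by
  induction s using Finset.induction_on generalizing N N' with
  | empty =>
    have e : (bump ∅ 0 : V → Fin 2 → ℕ) = bump ∅ 1 := by funext w j; simp [bump]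
    refine ⟨0, ?_, ?_, by simp⟩ <;>
    · rw [e, Finset.prod_empty]
      exact div_self (freeZ_pos h _ _ _).ne'
  | insert u s hu ih =>
    have hus := Finset.insert_subset_iff.1 hs
    obtain ⟨M, hM, hM', hMs⟩ := ih hus.2 (N + bump {u} 1) (N' + bump {u} 1)
    -- the edge to `u` is switched first, while those to `s` still lead to state `0`
    set M₁ : V → V → Fin 2 → ℕ := fun w => if w = u then bump s 0 else bump {u} 1 + M w with hM₁
    have key : ∀ N : V → Fin 2 → ℕ,
        freeZ β γ lam G W (N + bump {u} 1 + bump s 0) /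
          freeZ β γ lam G W (N + bump {u} 1 + bump s 1) =
          ∏ w ∈ s, edgeMap β γ (ratio β γ lam G W (N + bump {u} 1 + M w) w) →
        freeZ β γ lam G W (N + bump (insert u s) 0) /
          freeZ β γ lam G W (N + bump (insert u s) 1) =
          ∏ w ∈ insert u s, edgeMap β γ (ratio β γ lam G W (N + M₁ w) w) := by
      intro N hN
      rw [Finset.prod_insert hu, bump_insert hu, bump_insert hu, ← add_assoc, ← add_assoc]
      have e1 : ∏ w ∈ s, edgeMap β γ (ratio β γ lam G W (N + M₁ w) w) =
          ∏ w ∈ s, edgeMap β γ (ratio β γ lam G W (N + bump {u} 1 + M w) w) := by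
        refine Finset.prod_congr rfl fun w hw => ?_
        have e2 : M₁ w = bump {u} 1 + M w := if_neg (ne_of_mem_of_not_mem hw hu)
        rw [e2, add_assoc]
      have e2 : M₁ u = bump s 0 := if_pos rfl
      have e3 := freeZ_bump_div h G hus.1 (N + bump s 0)
      rw [add_right_comm, add_right_comm N _ (bump {u} 1)] at e3
      rw [e1, ← hN, e2, ← e3, div_mul_div_cancel₀ (freeZ_pos h _ _ _).ne']
    refine ⟨M₁, key N hM, key N' hM', fun w hw => ?_⟩
    by_cases hwu : w = u
    · subst hwu
      have e2 : M₁ w = bump s 0 := if_pos rfl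
      rw [e2]
      refine ⟨bump_apply_of_notMem hu 0, fun x => (bump_apply_add_le s 0 x).trans ?_⟩
      split_ifs <;> simp_all
    · have hws : w ∈ s := (Finset.mem_insert.1 hw).resolve_left hwu
      have e2 : M₁ w = bump {u} 1 + M w := if_neg hwu
      obtain ⟨f1, f2⟩ := hMs w hws
      rw [e2]
      refine ⟨?_, fun x => ?_⟩
      · rw [Pi.add_apply, f1, bump_apply_of_notMem (by simpa using hwu), add_zero]
      · have g1 := bump_apply_add_le {u} 1 x
        have g2 := f2 x
        simp only [Pi.add_apply, Finset.mem_insert, Finset.mem_singleton] at g1 g2 ⊢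
        by_cases hxu : x = u
        · subst hxu
          simp only [hu, if_true, if_false, true_or] at g1 g2 ⊢
          omega
        · simp only [hxu, if_false, false_or] at g1 g2 ⊢
          omega

/-- The recursion for the ratio at `v` in terms of the ratios at its neighbours after the deletion
of `v`, where some further neighbours of `v` may have received an additional pinned neighbour. -/
theorem exists_ratio_eq_prod [DecidableEq V] (h : AntiFerromagnetic β γ lam) (G : SimpleGraph V)
    {W : Finset V} {v : V} (s : Finset V)
    (hs : ∀ u, u ∈ s ↔ u ∈ W.erase v ∧ G.Adj v u) (N N' : V → Fin 2 → ℕ) :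
    ∃ M : V → V → Fin 2 → ℕ,
      ratio β γ lam G W N v = lam * β ^ N v 0 * (1 / γ) ^ N v 1 *
        ∏ u ∈ s, edgeMap β γ (ratio β γ lam G (W.erase v) (N + M u) u) ∧
      ratio β γ lam G W N' v = lam * β ^ N' v 0 * (1 / γ) ^ N' v 1 *
        ∏ u ∈ s, edgeMap β γ (ratio β γ lam G (W.erase v) (N' + M u) u) ∧
      ∀ u ∈ s, M u u = 0 ∧ ∀ w, M u w 0 + M u w 1 ≤ if w ∈ s then 1 else 0 := by
  obtain ⟨M, hM, hM', hMs⟩ := exists_freeZ_bump_div_eq_prod h G s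
    (W := W.erase v) (fun u hu => ((hs u).1 hu).1) N N'
  have key : ∀ N : V → Fin 2 → ℕ, ratio β γ lam G W N v =
      lam * β ^ N v 0 * (1 / γ) ^ N v 1 * (freeZ β γ lam G (W.erase v) (N + bump s 0) /
        freeZ β γ lam G (W.erase v) (N + bump s 1)) := by
    intro N
    have e : ∀ i, freeZ β γ lam G (W.erase v) (N + pinCount G {v} fun _ => i) =
        freeZ β γ lam G (W.erase v) (N + bump s i) := by
      intro i
      refine freeZ_congr β γ lam G fun x hx => ?_
      rw [Pi.add_apply, Pi.add_apply]
      congr 1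
      funext j
      unfold pinCount bump
      rw [Finset.filter_singleton]
      by_cases hadj : G.Adj v x
      · have : x ∈ s := (hs x).2 ⟨hx, hadj⟩
        by_cases hij : i = j
        · subst hij
          simp [hadj, this]
        · simp [hij, Ne.symm hij]
      · have : x ∉ s := fun hxs => hadj ((hs x).1 hxs).2
        simp [hadj, this]
    rw [← localField_div h, div_mul_div_comm, ← e, ← e]
    unfold ratio
    congr!
  refine ⟨M, ?_, ?_, hMs⟩
  · rw [key, hM]
  · rw [key, hM']

end
end

/-! ### Decay of correlation under uniqueness -/

section

variable {V : Type}

open Classical in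
/-- The number of neighbours of `w`, pinned or in `W`, in the system on `W` described by `N`. -/
noncomputable def load (G : SimpleGraph V) (W : Finset V) (N : V → Fin 2 → ℕ) (w : V) : ℕ :=
  N w 0 + N w 1 + Finset.card {u ∈ W | G.Adj w u}

theorem load_erase_le [DecidableEq V] {G : SimpleGraph V} {W : Finset V} {v : V} (hv : v ∈ W)
    {s : Finset V} (hs : ∀ u, u ∈ s ↔ u ∈ W.erase v ∧ G.Adj v u) {N M : V → Fin 2 → ℕ}
    (hM : ∀ w, M w 0 + M w 1 ≤ if w ∈ s then 1 else 0) (w : V) :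
    load G (W.erase v) (N + M) w ≤ load G W N w := by
  classical
  have hMw := hM w
  unfold load
  simp only [Pi.add_apply]
  rw [Finset.filter_erase]
  by_cases hws : w ∈ s
  · have hmem : v ∈ W.filter (fun u => G.Adj w u) :=
      Finset.mem_filter.2 ⟨hv, ((hs w).1 hws).2.symm⟩
    have := Finset.card_erase_add_one hmem
    rw [if_pos hws] at hMw
    omega
  · have := Finset.card_erase_le (s := W.filter (fun u => G.Adj w u)) (a := v)
    rw [if_neg hws] at hMw
    omega

theorem load_erase_lt [DecidableEq V] {G : SimpleGraph V} {W : Finset V} {v : V} (hv : v ∈ W)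
    {N M : V → Fin 2 → ℕ} {w : V} (hadj : G.Adj v w) (hM : M w = 0) :
    load G (W.erase v) (N + M) w < load G W N w := by
  classical
  unfold load
  simp only [Pi.add_apply, hM, Pi.zero_apply]
  rw [Finset.filter_erase]
  have hmem : v ∈ W.filter (fun u => G.Adj w u) := Finset.mem_filter.2 ⟨hv, hadj.symm⟩
  have := Finset.card_erase_add_one hmem
  omega

theorem mul_pow_mul_pow_mul_prod_eq {s : Finset V} (a b c : ℝ) (p q : ℕ) (f : V → ℝ) :
    c * a ^ p * b ^ q * ∏ u ∈ s, f u =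
      c * ∏ i : Fin p ⊕ Fin q ⊕ s, Sum.elim (fun _ => a) (Sum.elim (fun _ => b) fun u : s =>
        f u) i := by
  rw [Fintype.prod_sum_type, Fintype.prod_sum_type]
  simp only [Sum.elim_inl, Sum.elim_inr, Finset.prod_const, Finset.card_univ, Fintype.card_fin,
    Finset.univ_eq_attach]
  rw [Finset.prod_attach s f]
  ring

theorem load_eq_card [DecidableEq V] {G : SimpleGraph V} {W : Finset V} {v : V}
    {s : Finset V} (hs : ∀ u, u ∈ s ↔ u ∈ W.erase v ∧ G.Adj v u) (N : V → Fin 2 → ℕ) :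
    Fintype.card (Fin (N v 0) ⊕ Fin (N v 1) ⊕ s) = load G W N v := by
  classical
  have : W.filter (fun u => G.Adj v u) = s := by
    ext u
    rw [hs, Finset.mem_filter, Finset.mem_erase]
    constructor
    · exact fun h => ⟨⟨h.2.ne', h.1⟩, h.2⟩
    · exact fun h => ⟨h.1.2, h.2⟩
  unfold load
  rw [this]
  simp [add_assoc]

variable [Fintype V] {β γ lam : ℝ}

theorem ratio_le [DecidableEq V] (h : AntiFerromagnetic β γ lam) (G : SimpleGraph V)
    (W : Finset V) (N : V → Fin 2 → ℕ) (v : V) :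
    ratio β γ lam G W N v ≤ lam * (1 / γ) ^ load G W N v := by
  classical
  have hs : ∀ u, u ∈ (W.erase v).filter (fun u => G.Adj v u) ↔ u ∈ W.erase v ∧ G.Adj v u :=
    fun u => Finset.mem_filter
  obtain ⟨M, hM, -, -⟩ := exists_ratio_eq_prod h G _ hs N N
  rw [hM, mul_pow_mul_pow_mul_prod_eq, ← load_eq_card hs N, ← Finset.card_univ]
  refine mul_le_mul_of_nonneg_left ?_ h.lam_pos.le
  have hmem : ∀ i, (Sum.elim (fun _ => β) (Sum.elim (fun _ => 1 / γ) fun u :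
      ((W.erase v).filter (fun u => G.Adj v u)) =>
        edgeMap β γ (ratio β γ lam G (W.erase v) (N + M u) u)) :
      Fin (N v 0) ⊕ Fin (N v 1) ⊕ ((W.erase v).filter (fun u => G.Adj v u)) → ℝ) i ∈
      Set.Icc β (1 / γ) := by
    have hβγ : β ≤ 1 / γ := by
      rw [le_div_iff₀ h.gamma_pos]
      exact h.beta_mul_gamma_lt_one.le
    rintro (i | i | i)
    · exact ⟨le_rfl, hβγ⟩
    · exact ⟨hβγ, le_rfl⟩
    · exact edgeMap_mem_Icc h (ratio_nonneg h _ _ _ _)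
  calc _ ≤ ∏ _i, (1 / γ) := Finset.prod_le_prod (fun i _ => h.beta_nonneg.trans (hmem i).1)
        fun i _ => (hmem i).2
    _ = _ := Finset.prod_const _

/-- One step of the recursion, for two systems with the same pinned neighbours of `v`. -/
theorem close_ratio_of_forall_neighbor [DecidableEq V] (h : AntiFerromagnetic β γ lam)
    (G : SimpleGraph V) {W : Finset V} {v : V} (hv : v ∈ W) {N N' : V → Fin 2 → ℕ}
    (hN : N v = N' v) {c K : ℝ} (hc : 0 ≤ c) (hK0 : 0 ≤ K)
    (hK : TreeContraction β γ lam (load G W N v) K)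
    (hstep : ∀ u ∈ W.erase v, G.Adj v u → ∀ M : V → Fin 2 → ℕ, M u = 0 →
      (∀ N, ∀ w ∈ W.erase v, load G (W.erase v) (N + M) w ≤ load G W N w) →
      Close β γ c (edgeMap β γ (ratio β γ lam G (W.erase v) (N + M) u))
        (edgeMap β γ (ratio β γ lam G (W.erase v) (N' + M) u))) :
    Close β γ (c * √K) (edgeMap β γ (ratio β γ lam G W N v))
      (edgeMap β γ (ratio β γ lam G W N' v)) := by
  classical
  have hs : ∀ u, u ∈ (W.erase v).filter (fun u => G.Adj v u) ↔ u ∈ W.erase v ∧ G.Adj v u :=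
    fun u => Finset.mem_filter
  obtain ⟨M, hM, hM', hMs⟩ := exists_ratio_eq_prod h G _ hs N N'
  rw [← load_eq_card hs N] at hK
  rw [hM, hM', ← hN, mul_pow_mul_pow_mul_prod_eq, mul_pow_mul_pow_mul_prod_eq]
  have hβγ : β ≤ 1 / γ := by
    rw [le_div_iff₀ h.gamma_pos]
    exact h.beta_mul_gamma_lt_one.le
  refine Close.edgeMap_prod h hc hK0 hK ?_
  rintro (i | i | ⟨u, hu⟩)
  · exact Close.refl h hc ⟨le_rfl, hβγ⟩
  · exact Close.refl h hc ⟨hβγ, le_rfl⟩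
  · obtain ⟨hu1, hu2⟩ := (hs u).1 hu
    exact hstep u hu1 hu2 (M u) (hMs u hu).1 fun N w _ => load_erase_le hv hs (hMs u hu).2 w

/-- The bound `B` on the ratios keeps the messages away from `β`, where the metric is unbounded if
`β = 0`. -/
theorem close_ratio_of_load_le [DecidableEq V] (h : AntiFerromagnetic β γ lam)
    (G : SimpleGraph V) (W : Finset V) (v : V) (N N' : V → Fin 2 → ℕ) {B : ℝ} (hB0 : 0 ≤ B)
    (hN : lam * (1 / γ) ^ load G W N v ≤ B) (hN' : lam * (1 / γ) ^ load G W N' v ≤ B) :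
    Close β γ (2 / (γ * √(edgeMap β γ B * (edgeMap β γ B - β))))
      (edgeMap β γ (ratio β γ lam G W N v)) (edgeMap β γ (ratio β γ lam G W N' v)) := by
  have hlt : β < edgeMap β γ B := by
    unfold edgeMap
    rw [lt_div_iff₀ (by linarith [h.gamma_pos])]
    linarith [h.beta_mul_gamma_lt_one]
  have hmem : ∀ N, lam * (1 / γ) ^ load G W N v ≤ B →
      edgeMap β γ (ratio β γ lam G W N v) ∈ Set.Icc (edgeMap β γ B) (1 / γ) := fun N hN =>
    ⟨edgeMap_anti h (ratio_nonneg h _ _ _ _) ((ratio_le h G W N v).trans hN),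
      (edgeMap_mem_Icc h (ratio_nonneg h _ _ _ _)).2⟩
  exact close_of_ge h hlt (hmem N hN) (hmem N' hN')

/-- Decay of correlation: systems which agree near `v` send nearly the same message. -/
theorem close_ratio_of_agree [DecidableEq V] (h : AntiFerromagnetic β γ lam)
    (G : SimpleGraph V) {Δ : ℕ∞} {K B : ℝ} (hK0 : 0 ≤ K) (hB0 : 0 ≤ B)
    (hK : ∀ d : ℕ, (d : ℕ∞) < Δ → TreeContraction β γ lam d K)
    (hB : ∀ d : ℕ, (d : ℕ∞) ≤ Δ → lam * (1 / γ) ^ d ≤ B) (m : ℕ) :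
    ∀ (W : Finset V) (N N' : V → Fin 2 → ℕ) (v : V), v ∈ W →
      (∀ w ∈ W, (load G W N w : ℕ∞) ≤ Δ) → (∀ w ∈ W, (load G W N' w : ℕ∞) ≤ Δ) →
      (load G W N v : ℕ∞) < Δ → (∀ w, G.edist v w < m → N w = N' w) →
      Close β γ (2 / (γ * √(edgeMap β γ B * (edgeMap β γ B - β))) * √K ^ m)
        (edgeMap β γ (ratio β γ lam G W N v)) (edgeMap β γ (ratio β γ lam G W N' v)) := by
  have hγ := h.gamma_pos
  induction m with
  | zero =>
    intro W N N' v hv hl hl' _ _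
    rw [pow_zero, mul_one]
    exact close_ratio_of_load_le h G W v N N' hB0 (hB _ (hl v hv)) (hB _ (hl' v hv))
  | succ m ih =>
    intro W N N' v hv hl hl' hlt hagree
    have hvv : N v = N' v := hagree v (by rw [SimpleGraph.edist_self]; exact_mod_cast m.succ_pos)
    rw [pow_succ, ← mul_assoc]
    refine close_ratio_of_forall_neighbor h G hv hvv (by positivity) hK0 (hK _ hlt) ?_
    intro u hu hadj M hMu hload
    have hload' : ∀ N : V → Fin 2 → ℕ, (∀ w ∈ W, (load G W N w : ℕ∞) ≤ Δ) →
        ∀ w ∈ W.erase v, (load G (W.erase v) (N + M) w : ℕ∞) ≤ Δ := fun N hl w hw =>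
      le_trans (by exact_mod_cast hload N w hw) (hl w (Finset.mem_of_mem_erase hw))
    refine ih (W.erase v) _ _ u hu (hload' N hl) (hload' N' hl') ?_ fun w hw => ?_
    · exact lt_of_lt_of_le (by exact_mod_cast load_erase_lt hv hadj hMu)
        (hl u (Finset.mem_of_mem_erase hu))
    · rw [Pi.add_apply, Pi.add_apply, hagree w ?_]
      refine lt_of_le_of_lt (SimpleGraph.edist_triangle (v := u)) ?_
      rw [SimpleGraph.edist_eq_one_iff_adj.2 hadj, add_comm]
      exact lt_of_le_of_lt (Order.add_one_le_of_lt hw) (by exact_mod_cast m.lt_succ_self)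

open Classical in
theorem weight_eq_freeWeight (β γ lam : ℝ) (G : SimpleGraph V) (σ : V → Fin 2) :
    weight β γ lam G σ = freeWeight β γ lam G Finset.univ 0 σ := by
  simp [weight, freeWeight, innerWeight, localField]

theorem weight_nonneg (h : AntiFerromagnetic β γ lam) (G : SimpleGraph V) (σ : V → Fin 2) :
    0 ≤ weight β γ lam G σ := by
  rw [weight_eq_freeWeight]
  exact freeWeight_nonneg h _ _ _ _

open Classical in
theorem configs_univ : configs (Finset.univ : Finset V) = Finset.univ := by
  simp [configs]

theorem partitionFunction_pos (h : AntiFerromagnetic β γ lam) (G : SimpleGraph V) :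
    0 < partitionFunction β γ lam G := by
  have := freeZ_pos h G Finset.univ 0
  unfold partitionFunction
  simp only [weight_eq_freeWeight]
  rwa [freeZ, configs_univ] at this

open Classical in
theorem gibbsProb_eq (β γ lam : ℝ) (G : SimpleGraph V) (A : Set (V → Fin 2)) :
    gibbsProb β γ lam G A =
      (∑ σ with σ ∈ A, weight β γ lam G σ) / partitionFunction β γ lam G := by
  rw [gibbsProb, Finset.sum_div]

open Classical in
/-- Conditioning on the configuration of `B` amounts to deleting `B` and pinning neighbours. -/
theorem marginal_eq_ratio [inst : DecidableEq V] (h : AntiFerromagnetic β γ lam)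
    (G : SimpleGraph V) {Λ : Set V} (σΛ : Λ → Fin 2) (hf : Feasible β γ lam G σΛ)
    {B W : Finset V} (hB : ∀ u, u ∈ B ↔ u ∈ Λ) (hW : ∀ u, u ∈ W ↔ u ∉ Λ)
    {ρ : V → Fin 2} (hρ : ∀ u : Λ, ρ u = σΛ u) {v : V} (hv : v ∉ Λ) :
    marginal β γ lam G σΛ v =
      ratio β γ lam G W (pinCount G B ρ) v / (1 + ratio β γ lam G W (pinCount G B ρ) v) := by
  obtain rfl : inst = fun a b => Classical.propDecidable (a = b) := Subsingleton.elim _ _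
  obtain rfl : W = Finset.univ \ B := by
    ext u
    simp [hB, hW]
  have hvW : v ∈ Finset.univ \ B := by simp [hB, hv]
  set c := innerWeight β γ G B ρ * ∏ w ∈ B, localField β γ lam ((0 : V → Fin 2 → ℕ) w) (ρ w)
    with hc
  have hag : ∀ σ, σ ∈ agrees σΛ ↔ ∀ w ∈ B, σ w = ρ w := fun σ =>
    ⟨fun hσ w hw => (hσ ⟨w, (hB w).1 hw⟩).trans (hρ ⟨w, (hB w).1 hw⟩).symm,
      fun hσ u => (hσ u ((hB u).2 u.2)).trans (hρ u)⟩
  have e1 : gibbsProb β γ lam G (agrees σΛ) =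
      c * freeZ β γ lam G (Finset.univ \ B) (pinCount G B ρ) / partitionFunction β γ lam G := by
    rw [gibbsProb_eq]
    congr 1
    have := sum_pinned_eq β γ lam G (Finset.subset_univ B) 0 ρ (fun _ => True)
      fun _ _ _ => Iff.rfl
    rw [configs_univ, zero_add] at this
    simp only [hag, weight_eq_freeWeight]
    simpa [freeZ, hc] using this
  have e2 : gibbsProb β γ lam G ({σ : V → Fin 2 | σ v = 0} ∩ agrees σΛ) =
      c * (localField β γ lam (pinCount G B ρ v) 0 * freeZ β γ lam G ((Finset.univ \ B).erase v)
        (pinCount G B ρ + pinCount G {v} fun _ => 0)) / partitionFunction β γ lam G := by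
    rw [gibbsProb_eq]
    congr 1
    have := sum_pinned_eq β γ lam G (Finset.subset_univ B) 0 ρ (fun σ => σ v = 0)
      fun σ τ hστ => by rw [hστ v hvW]
    rw [configs_univ, zero_add] at this
    rw [hc, ← sum_configs_eq β γ lam G hvW]
    simp only [Set.mem_inter_iff, Set.mem_ofPred_eq, hag, weight_eq_freeWeight]
    convert this using 2
    · simp only [and_comm]
    · congr!
  have hZ := partitionFunction_pos h G
  have hc0 : c ≠ 0 := by
    intro hc0
    unfold Feasible at hf
    rw [e1, hc0, zero_mul, zero_div] at hf
    exact lt_irrefl _ hf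
  unfold marginal
  rw [e1, e2, div_div_div_cancel_right₀ hZ.ne',
    mul_div_mul_left _ _ hc0, freeZ_eq_add β γ lam G hvW]
  unfold ratio
  have p0 := localField_nonneg h (pinCount G B ρ v) 0
  have p1 := localField_one_pos h (pinCount G B ρ v)
  have q0 := freeZ_pos h G ((Finset.univ \ B).erase v)
    (pinCount G B ρ + pinCount G {v} fun _ => 0)
  have q1 := freeZ_pos h G ((Finset.univ \ B).erase v)
    (pinCount G B ρ + pinCount G {v} fun _ => 1)
  have r1 := mul_pos p1 q1
  have r0 := mul_nonneg p0 q0.le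
  generalize localField β γ lam (pinCount G B ρ v) 0 * freeZ β γ lam G
    ((Finset.univ \ B).erase v) (pinCount G B ρ + pinCount G {v} fun _ => 0) = a at r0
  generalize localField β γ lam (pinCount G B ρ v) 1 * freeZ β γ lam G
    ((Finset.univ \ B).erase v) (pinCount G B ρ + pinCount G {v} fun _ => 1) = b at r1
  field_simp
  ring

theorem marginal_of_mem (β γ lam : ℝ) (G : SimpleGraph V) {Λ : Set V} (σΛ : Λ → Fin 2)
    (hf : Feasible β γ lam G σΛ) {v : V} (hv : v ∈ Λ) :
    marginal β γ lam G σΛ v = if σΛ ⟨v, hv⟩ = 0 then 1 else 0 := by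
  unfold marginal
  split_ifs with h0
  · have : {σ : V → Fin 2 | σ v = 0} ∩ agrees σΛ = agrees σΛ :=
      Set.inter_eq_right.2 fun σ hσ => (hσ ⟨v, hv⟩).trans h0
    rw [this, div_self (ne_of_gt hf)]
  · have : {σ : V → Fin 2 | σ v = 0} ∩ agrees σΛ = ∅ := by
      ext σ
      simp only [Set.mem_inter_iff, Set.mem_ofPred_eq, Set.mem_empty_iff_false, iff_false, not_and]
      exact fun h1 hσ => h0 ((hσ ⟨v, hv⟩).symm.trans h1)
    rw [this]
    simp [gibbsProb]

theorem load_pinCount_le [DecidableEq V] {G : SimpleGraph V} {Δ : ℕ∞}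
    (hG : MaxDegreeAtMost Δ V G) (B : Finset V) (ρ : V → Fin 2) (w : V) :
    (load G (Finset.univ \ B) (pinCount G B ρ) w : ℕ∞) ≤ Δ := by
  classical
  refine le_trans ?_ (hG w)
  have hcoe : G.neighborSet w = ((Finset.univ.filter fun u => G.Adj w u : Finset V) : Set V) := by
    ext u
    simp
  rw [hcoe, Set.encard_coe_eq_coe_finsetCard, Nat.cast_le]
  unfold load pinCount
  rw [← Finset.card_union_of_disjoint, ← Finset.card_union_of_disjoint]
  · refine Finset.card_le_card fun u hu => ?_
    simp only [Finset.mem_union, Finset.mem_filter] at hu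
    simp only [Finset.mem_filter, Finset.mem_univ, true_and]
    rcases hu with (hu | hu) | hu
    exacts [hu.2.1.symm, hu.2.1.symm, hu.2]
  · rw [Finset.disjoint_left]
    intro u hu hu'
    simp only [Finset.mem_union, Finset.mem_filter, Finset.mem_sdiff] at hu hu'
    rcases hu with hu | hu <;> exact hu'.1.2 hu.1
  · rw [Finset.disjoint_left]
    intro u hu hu'
    simp only [Finset.mem_filter] at hu hu'
    exact absurd (hu.2.2.symm.trans hu'.2.2) (by decide)

theorem abs_div_one_add_sub_le (h : AntiFerromagnetic β γ lam) {x x' : ℝ} (hx : 0 ≤ x)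
    (hx' : 0 ≤ x') :
    |x / (1 + x) - x' / (1 + x')| ≤
      (1 + γ) ^ 2 / (1 - β * γ) * |edgeMap β γ x - edgeMap β γ x'| := by
  have hγ := h.gamma_pos
  have hq : 0 < 1 - β * γ := sub_pos.2 h.beta_mul_gamma_lt_one
  have e1 : x / (1 + x) - x' / (1 + x') = (x - x') / ((1 + x) * (1 + x')) := by
    field_simp
    ring
  rw [e1, edgeMap_sub h hx hx', abs_neg, abs_div, abs_div,
    abs_mul (1 - β * γ), abs_of_pos hq,
    abs_of_pos (by positivity : 0 < (1 + x) * (1 + x')),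
    abs_of_pos (by positivity : 0 < (x + γ) * (x' + γ))]
  have e2 : (1 + γ) ^ 2 / (1 - β * γ) * ((1 - β * γ) * |x - x'| / ((x + γ) * (x' + γ))) =
      |x - x'| * ((1 + γ) ^ 2 / ((x + γ) * (x' + γ))) := by
    generalize 1 - β * γ = q at hq ⊢
    field_simp
  rw [e2, div_eq_mul_one_div]
  refine mul_le_mul_of_nonneg_left ?_ (abs_nonneg _)
  rw [div_le_div_iff₀ (by positivity) (by positivity)]
  have f1 : x + γ ≤ (1 + γ) * (1 + x) := by nlinarith
  have f2 : x' + γ ≤ (1 + γ) * (1 + x') := by nlinarith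
  calc 1 * ((x + γ) * (x' + γ)) ≤ ((1 + γ) * (1 + x)) * ((1 + γ) * (1 + x')) := by
        rw [one_mul]
        gcongr
    _ = _ := by ring

theorem marginal_mem_Icc (h : AntiFerromagnetic β γ lam) (G : SimpleGraph V) {Λ : Set V}
    (σΛ : Λ → Fin 2) (v : V) : marginal β γ lam G σΛ v ∈ Set.Icc (0 : ℝ) 1 := by
  classical
  have hn : ∀ A : Set (V → Fin 2), 0 ≤ gibbsProb β γ lam G A := fun A =>
    Finset.sum_nonneg fun σ _ => div_nonneg (weight_nonneg h G σ) (partitionFunction_pos h G).le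
  refine ⟨div_nonneg (hn _) (hn _), div_le_one_of_le₀ ?_ (hn _)⟩
  refine Finset.sum_le_sum_of_subset_of_nonneg (fun σ hσ => ?_) fun σ _ _ =>
    div_nonneg (weight_nonneg h G σ) (partitionFunction_pos h G).le
  simp only [Finset.mem_filter, Finset.mem_univ, true_and] at hσ ⊢
  exact hσ.2

end

theorem strongSpatialMixing_of_uniqueUpTo {β γ lam : ℝ} (h : AntiFerromagnetic β γ lam) {Δ : ℕ∞}
    (hu : UniqueUpTo β γ lam Δ) :
    StrongSpatialMixing β γ lam (MaxDegreeAtMost Δ) := by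
  obtain ⟨K, hK0, hK1, L, hL0, B, hB0, hK, hL, hB⟩ := exists_uniform_treeContraction h hu
  have hγ := h.gamma_pos
  have hq : 0 < 1 - β * γ := sub_pos.2 h.beta_mul_gamma_lt_one
  set c := 2 / (γ * √(edgeMap β γ B * (edgeMap β γ B - β))) with hc
  set κ := √K with hκ
  have hκ0 : 0 < κ := Real.sqrt_pos.2 hK0
  have hκ1 : κ < 1 := by
    rw [hκ, Real.sqrt_lt' one_pos, one_pow]
    exact hK1
  set A := (1 + γ) ^ 2 / (1 - β * γ) * (c * √L / γ) with hA
  have hA0 : 0 ≤ A := by positivity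
  -- Two powers of `κ` are lost: the systems obtained by pinning agree only at distance less than
  -- `n - 1`, and the step at the root contracts by `√L` instead of `κ`. The summand `κ⁻¹` takes
  -- care of `n ≤ 1`.
  refine ⟨κ⁻¹ + A * (κ⁻¹) ^ 2, by positivity, -Real.log κ, neg_pos.2 (Real.log_neg hκ0 hκ1), ?_⟩
  intro V _ G hG v Λ σΛ τΛ hσ hτ n hn
  have hexp : Real.exp (-(-Real.log κ) * n) = κ ^ n := by
    rw [neg_neg, mul_comm, Real.exp_nat_mul, Real.exp_log hκ0]
  rw [hexp]
  rcases Nat.lt_or_ge n 2 with hn2 | hn2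
  · obtain ⟨a0, a1⟩ := marginal_mem_Icc h G σΛ v
    obtain ⟨b0, b1⟩ := marginal_mem_Icc h G τΛ v
    have h1 : |marginal β γ lam G σΛ v - marginal β γ lam G τΛ v| ≤ 1 := by
      rw [abs_le]
      constructor <;> linarith
    refine h1.trans ?_
    have h2 : κ ≤ κ ^ n := by
      calc κ = κ ^ 1 := (pow_one _).symm
        _ ≤ κ ^ n := pow_le_pow_of_le_one hκ0.le hκ1.le (by omega)
    calc (1 : ℝ) = κ⁻¹ * κ := (inv_mul_cancel₀ hκ0.ne').symm
      _ ≤ (κ⁻¹ + A * (κ⁻¹) ^ 2) * κ ^ n := by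
          gcongr
          have : 0 ≤ A * (κ⁻¹) ^ 2 := by positivity
          linarith
  obtain ⟨m, rfl⟩ : ∃ m, n = m + 2 := ⟨n - 2, by omega⟩
  have hfar : ∀ u ∈ disagreement σΛ τΛ, ((m + 2 : ℕ) : ℕ∞) ≤ G.edist v u := fun u hu =>
    hn.trans (iInf₂_le u hu)
  have hbound : A * κ ^ m ≤ (κ⁻¹ + A * (κ⁻¹) ^ 2) * κ ^ (m + 2) := by
    have : A * κ ^ m = A * (κ⁻¹) ^ 2 * κ ^ (m + 2) := by
      rw [pow_add]
      field_simp
    rw [this]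
    gcongr
    have : 0 < κ⁻¹ := by positivity
    linarith
  by_cases hv : v ∈ Λ
  · have hvS : v ∉ disagreement σΛ τΛ := fun hvS => by
      have := hfar v hvS
      rw [SimpleGraph.edist_self] at this
      exact absurd this (by simp)
    have heq : σΛ ⟨v, hv⟩ = τΛ ⟨v, hv⟩ := by
      by_contra hne
      exact hvS ⟨hv, hne⟩
    rw [marginal_of_mem β γ lam G σΛ hσ hv, marginal_of_mem β γ lam G τΛ hτ hv, heq, sub_self,
      abs_zero]
    positivity
  classical
  set B' := Λ.toFinset with hB'
  have hBmem : ∀ u, u ∈ B' ↔ u ∈ Λ := fun u => Set.mem_toFinset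
  set ρ : V → Fin 2 := fun u => if hu : u ∈ Λ then σΛ ⟨u, hu⟩ else 1 with hρ
  set ρ' : V → Fin 2 := fun u => if hu : u ∈ Λ then τΛ ⟨u, hu⟩ else 1 with hρ'
  have hρ1 : ∀ u : Λ, ρ u = σΛ u := fun u => by simp [hρ]
  have hρ1' : ∀ u : Λ, ρ' u = τΛ u := fun u => by simp [hρ']
  set W := Finset.univ \ B' with hW
  have hWmem : ∀ u, u ∈ W ↔ u ∉ Λ := fun u => by simp [hW, hBmem]
  rw [marginal_eq_ratio h G σΛ hσ hBmem hWmem hρ1 hv,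
    marginal_eq_ratio h G τΛ hτ hBmem hWmem hρ1' hv]
  have hvW : v ∈ W := (hWmem v).2 hv
  have hagree : ∀ w, G.edist v w < (m + 1 : ℕ) → pinCount G B' ρ w = pinCount G B' ρ' w := by
    intro w hw
    funext s
    unfold pinCount
    congr 1
    refine Finset.filter_congr fun u hu => and_congr_right fun hadj => ?_
    have huΛ := (hBmem u).1 hu
    have hlt : G.edist v u < (m + 2 : ℕ) := by
      refine lt_of_le_of_lt (SimpleGraph.edist_triangle (v := w)) ?_
      rw [SimpleGraph.edist_eq_one_iff_adj.2 hadj.symm]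
      exact lt_of_le_of_lt (Order.add_one_le_of_lt hw) (by exact_mod_cast (m + 1).lt_succ_self)
    have huS : σΛ ⟨u, huΛ⟩ = τΛ ⟨u, huΛ⟩ := by
      by_contra hne
      exact absurd (hfar u ⟨huΛ, hne⟩) (not_le.2 hlt)
    rw [hρ1 ⟨u, huΛ⟩, hρ1' ⟨u, huΛ⟩, huS]
  have hclose : Close β γ (c * κ ^ m * √L)
      (edgeMap β γ (ratio β γ lam G W (pinCount G B' ρ) v))
      (edgeMap β γ (ratio β γ lam G W (pinCount G B' ρ') v)) := by
    refine close_ratio_of_forall_neighbor h G hvW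
      (hagree v (by rw [SimpleGraph.edist_self]; exact_mod_cast m.succ_pos))
      (by positivity) hL0 (hL _ (load_pinCount_le hG B' ρ v)) ?_
    intro u hu hadj M hMu hload
    have hload' : ∀ ρ : V → Fin 2, ∀ w ∈ W.erase v,
        (load G (W.erase v) (pinCount G B' ρ + M) w : ℕ∞) ≤ Δ := fun ρ w hw =>
      le_trans (by exact_mod_cast hload _ w hw) (load_pinCount_le hG B' ρ w)
    refine close_ratio_of_agree h G hK0.le hB0 hK hB m (W.erase v) _ _ u hu (hload' ρ)
      (hload' ρ') ?_ fun w hw => ?_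
    · exact lt_of_lt_of_le (by exact_mod_cast load_erase_lt hvW hadj hMu)
        (load_pinCount_le hG B' ρ u)
    · rw [Pi.add_apply, Pi.add_apply, hagree w ?_]
      refine lt_of_le_of_lt (SimpleGraph.edist_triangle (v := u)) ?_
      rw [SimpleGraph.edist_eq_one_iff_adj.2 hadj, add_comm]
      exact lt_of_le_of_lt (Order.add_one_le_of_lt hw) (by exact_mod_cast m.lt_succ_self)
  refine (abs_div_one_add_sub_le h (ratio_nonneg h _ _ _ _) (ratio_nonneg h _ _ _ _)).trans ?_
  refine le_trans ?_ hbound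
  calc (1 + γ) ^ 2 / (1 - β * γ) * |edgeMap β γ (ratio β γ lam G W (pinCount G B' ρ) v) -
        edgeMap β γ (ratio β γ lam G W (pinCount G B' ρ') v)|
      ≤ (1 + γ) ^ 2 / (1 - β * γ) * (c * κ ^ m * √L / γ) := by
        gcongr
        exact hclose.abs_sub_le h (by positivity)
    _ = A * κ ^ m := by
        rw [hA]
        ring

/-! ### Rate of convergence of the recursion -/

section

variable {β γ lam : ℝ}

open Filter Topology

theorem treeRec_anti (h : AntiFerromagnetic β γ lam) (d : ℕ) {x x' : ℝ} (hx : 0 ≤ x)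
    (hxx' : x ≤ x') : treeRec β γ lam d x' ≤ treeRec β γ lam d x := by
  rw [treeRec_eq, treeRec_eq]
  have := h.lam_pos
  have := edgeMap_pos h (hx.trans hxx')
  have := edgeMap_anti h hx hxx'
  gcongr

theorem treeRec_injOn (h : AntiFerromagnetic β γ lam) {d : ℕ} (hd : 1 ≤ d) {x x' : ℝ}
    (hx : 0 ≤ x) (hx' : 0 ≤ x') (heq : treeRec β γ lam d x = treeRec β γ lam d x') : x = x' := by
  rw [treeRec_eq, treeRec_eq] at heq
  have h1 := mul_left_cancel₀ h.lam_pos.ne' heq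
  have h2 := (pow_left_inj₀ (edgeMap_pos h hx).le (edgeMap_pos h hx').le (by omega)).1 h1
  have h3 := edgeMap_sub h hx hx'
  have hγ := h.gamma_pos
  have hq : 1 - β * γ ≠ 0 := (sub_pos.2 h.beta_mul_gamma_lt_one).ne'
  rw [h2, sub_self, eq_comm, neg_eq_zero, div_eq_zero_iff, mul_eq_zero] at h3
  have h4 : (x + γ) * (x' + γ) ≠ 0 := by positivity
  exact sub_eq_zero.1 ((h3.resolve_right h4).resolve_left hq)

theorem treeRec_mem_Icc (h : AntiFerromagnetic β γ lam) (d : ℕ) {x : ℝ} (hx : 0 ≤ x) :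
    treeRec β γ lam d x ∈ Set.Icc (lam * β ^ d) (lam * (1 / γ) ^ d) := by
  obtain ⟨h1, h2⟩ := edgeMap_mem_Icc h hx
  have := h.lam_pos
  have := h.beta_nonneg
  have := edgeMap_pos h hx
  rw [treeRec_eq]
  constructor <;> gcongr

/-- If the values at the root of the `d`-ary tree under the two extremal boundary conditions
approach each other exponentially fast, then the fixed point of the recursion is strictly
attracting: near the fixed point, an orbit cannot converge at a rate better than the derivative. -/
theorem uniqueOnRegularTree_of_exponential (h : AntiFerromagnetic β γ lam) {d : ℕ} (hd : 1 ≤ d)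
    {C α : ℝ} (hα : 0 < α)
    (hdecay : ∀ n : ℕ,
      |(treeRec β γ lam d)^[n] (lam * β ^ d) / (1 + (treeRec β γ lam d)^[n] (lam * β ^ d)) -
        (treeRec β γ lam d)^[n] (lam * (1 / γ) ^ d) /
          (1 + (treeRec β γ lam d)^[n] (lam * (1 / γ) ^ d))| ≤
        C * Real.exp (-α * (n + 1 : ℕ))) :
    UniqueOnRegularTree β γ lam d := by
  have hβ := h.beta_nonneg
  have hγ := h.gamma_pos
  have hlam := h.lam_pos
  obtain ⟨x₀, ⟨hx₀, hfix⟩, -⟩ := existsUnique_fixedPoint h d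
  refine ⟨x₀, ⟨hx₀, hfix⟩, ?_⟩
  by_contra! hge
  set f := treeRec β γ lam d with hf
  set M := lam * (1 / γ) ^ d with hM
  set u : ℕ → ℝ := fun n => f^[n] M with hu
  set w : ℕ → ℝ := fun n => f^[n] (lam * β ^ d) with hw
  have hfM : ∀ x, 0 ≤ x → 0 ≤ f x ∧ f x ≤ M := fun x hx =>
    ⟨le_trans (by positivity) (treeRec_mem_Icc h d hx).1, (treeRec_mem_Icc h d hx).2⟩
  have hβM : lam * β ^ d ≤ M :=
    (treeRec_mem_Icc h d le_rfl).1.trans (treeRec_mem_Icc h d le_rfl).2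
  have hrange : ∀ z, 0 ≤ z → z ≤ M → ∀ n, 0 ≤ f^[n] z ∧ f^[n] z ≤ M := by
    intro z hz hz' n
    induction n with
    | zero => exact ⟨hz, hz'⟩
    | succ n ih =>
      rw [Function.iterate_succ_apply']
      exact hfM _ ih.1
  have hu0 := hrange M (by positivity) le_rfl
  have hw0 := hrange (lam * β ^ d) (by positivity) hβM
  -- the fixed point lies between the two orbits
  have hbetween : ∀ n, (w n ≤ x₀ ∧ x₀ ≤ u n) ∨ (u n ≤ x₀ ∧ x₀ ≤ w n) := by
    intro n
    induction n with
    | zero =>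
      have := treeRec_mem_Icc h d hx₀.le
      rw [← hf, hfix] at this
      exact Or.inl this
    | succ n ih =>
      have e1 : u (n + 1) = f (u n) := Function.iterate_succ_apply' _ _ _
      have e2 : w (n + 1) = f (w n) := Function.iterate_succ_apply' _ _ _
      rw [e1, e2, ← hfix]
      rcases ih with ⟨a, b⟩ | ⟨a, b⟩
      · exact Or.inr ⟨treeRec_anti h d hx₀.le b, treeRec_anti h d (hw0 n).1 a⟩
      · exact Or.inl ⟨treeRec_anti h d hx₀.le b, treeRec_anti h d (hu0 n).1 a⟩
  have hne : ∀ n, u n ≠ x₀ := by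
    intro n
    induction n with
    | zero =>
      intro h0
      have e : f 0 = M := by
        rw [hf, treeRec_eq, hM]
        simp [edgeMap]
      have : f 0 = f x₀ := by rw [e, hfix]; exact h0
      exact hx₀.ne (treeRec_injOn h hd le_rfl hx₀.le this)
    | succ n ih =>
      intro h0
      have e1 : u (n + 1) = f (u n) := Function.iterate_succ_apply' _ _ _
      rw [e1, ← hfix] at h0
      exact ih (treeRec_injOn h hd (hu0 n).1 hx₀.le h0)
  set r := Real.exp (-α) with hr
  have hr0 : 0 < r := Real.exp_pos _
  have hr1 : r < 1 := Real.exp_lt_one_iff.2 (neg_lt_zero.2 hα)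
  have hbound : ∀ n, |u n - x₀| ≤ (1 + M) ^ 2 * C * r ^ (n + 1) := by
    intro n
    have h1 := hdecay n
    rw [show (-α * (n + 1 : ℕ) : ℝ) = ((n + 1 : ℕ) : ℝ) * -α by ring, Real.exp_nat_mul] at h1
    obtain ⟨a0, a1⟩ := hu0 n
    obtain ⟨b0, b1⟩ := hw0 n
    change |w n / (1 + w n) - u n / (1 + u n)| ≤ C * r ^ (n + 1) at h1
    change 0 ≤ u n at a0
    change u n ≤ M at a1
    change 0 ≤ w n at b0
    change w n ≤ M at b1
    have e : u n - w n = -((1 + u n) * (1 + w n) * (w n / (1 + w n) - u n / (1 + u n))) := by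
      field_simp
      ring
    have h2 : |u n - x₀| ≤ |u n - w n| := by
      rcases hbetween n with ⟨a, b⟩ | ⟨a, b⟩
      · rw [abs_of_nonneg (by linarith), abs_of_nonneg (by linarith)]
        linarith
      · rw [abs_of_nonpos (by linarith), abs_of_nonpos (by linarith)]
        linarith
    refine h2.trans ?_
    rw [e, abs_neg, abs_mul, abs_of_nonneg (by positivity)]
    calc (1 + u n) * (1 + w n) * |w n / (1 + w n) - u n / (1 + u n)|
        ≤ (1 + M) * (1 + M) * (C * r ^ (n + 1)) := by gcongr
      _ = _ := by ring
  -- a rate strictly between `r` and the derivative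
  set q := (1 + r) / 2 with hq
  have hrq : r < q := by rw [hq]; linarith
  have hq1 : q < 1 := by rw [hq]; linarith
  have hq0 : 0 < q := hr0.trans hrq
  have hder : HasDerivAt f (deriv f x₀) x₀ := by
    have := ((hasDerivAt_edgeMap h hx₀.le).pow d).const_mul lam
    exact (HasDerivAt.differentiableAt (f := f) this).hasDerivAt
  have hexpand : ∀ᶠ x in 𝓝[≠] x₀, q * |x - x₀| ≤ |f x - x₀| := by
    have h1 := (hasDerivAt_iff_tendsto_slope.1 hder).abs
    filter_upwards [h1.eventually (lt_mem_nhds (hq1.trans_le hge)), self_mem_nhdsWithin]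
      with x hx hxne
    have hxne' : 0 < |x - x₀| := abs_pos.2 (sub_ne_zero.2 hxne)
    rw [slope_def_field, hfix, abs_div, lt_div_iff₀ hxne'] at hx
    exact hx.le
  have hlim : Tendsto u atTop (𝓝[≠] x₀) := by
    refine tendsto_nhdsWithin_iff.2 ⟨?_, Eventually.of_forall hne⟩
    rw [tendsto_iff_dist_tendsto_zero]
    have h0 : Tendsto (fun n : ℕ => (1 + M) ^ 2 * C * r ^ (n + 1)) atTop (𝓝 0) := by
      have := (((tendsto_pow_atTop_nhds_zero_of_lt_one hr0.le hr1).comp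
        (tendsto_add_atTop_nat 1))).const_mul ((1 + M) ^ 2 * C)
      simpa using this
    exact squeeze_zero (fun n => dist_nonneg) (fun n => by rw [Real.dist_eq]; exact hbound n) h0
  obtain ⟨n₀, hn₀⟩ := eventually_atTop.1 (hlim.eventually hexpand)
  have hlow : ∀ k, q ^ k * |u n₀ - x₀| ≤ |u (n₀ + k) - x₀| := by
    intro k
    induction k with
    | zero => simp
    | succ k ih =>
      have e1 : u (n₀ + (k + 1)) = f (u (n₀ + k)) := Function.iterate_succ_apply' _ _ _
      rw [e1]
      calc q ^ (k + 1) * |u n₀ - x₀| = q * (q ^ k * |u n₀ - x₀|) := by ring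
        _ ≤ q * |u (n₀ + k) - x₀| := by gcongr
        _ ≤ _ := hn₀ _ (Nat.le_add_right _ _)
  have hzero : |u n₀ - x₀| ≤ 0 := by
    have h0 : Tendsto (fun k : ℕ => (1 + M) ^ 2 * C * r ^ (n₀ + 1) * (r / q) ^ k) atTop (𝓝 0) := by
      have := (tendsto_pow_atTop_nhds_zero_of_lt_one (by positivity : 0 ≤ r / q)
        ((div_lt_one hq0).2 hrq)).const_mul ((1 + M) ^ 2 * C * r ^ (n₀ + 1))
      simpa using this
    refine ge_of_tendsto' h0 fun k => ?_
    have h1 := (hlow k).trans (hbound (n₀ + k))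
    rw [div_pow, ← mul_div_assoc, le_div_iff₀ (by positivity), mul_comm]
    refine h1.trans (le_of_eq ?_)
    ring
  exact hne n₀ (sub_eq_zero.1 (abs_nonpos_iff.1 hzero))

end

/-! ### Regular trees of finite depth -/

/-- The vertices of the `d`-ary tree of depth `n`: a vertex is the list of choices on the way from
the root, most recent choice first. -/
abbrev TreeVertex (d n : ℕ) : Type := {l : List (Fin d) // l.length ≤ n}

noncomputable instance (d n : ℕ) : Fintype (TreeVertex d n) :=
  (List.finite_length_le (Fin d) n).fintype

/-- The `d`-ary tree of depth `n`. -/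
def treeGraph (d n : ℕ) : SimpleGraph (TreeVertex d n) where
  Adj u w := (∃ a, u.1 = a :: w.1) ∨ ∃ a, w.1 = a :: u.1
  symm := ⟨fun _ _ h => h.symm⟩
  loopless := ⟨fun u h => by
    rcases h with ⟨a, h⟩ | ⟨a, h⟩ <;> simpa using congrArg List.length h⟩

section

variable {d n : ℕ}

theorem treeGraph_adj {u w : TreeVertex d n} :
    (treeGraph d n).Adj u w ↔ (∃ a, u.1 = a :: w.1) ∨ ∃ a, w.1 = a :: u.1 := Iff.rfl

theorem treeGraph_maxDegreeAtMost (d n : ℕ) {Δ : ℕ∞} (hd : (d : ℕ∞) + 1 ≤ Δ) :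
    MaxDegreeAtMost Δ (TreeVertex d n) (treeGraph d n) := by
  intro v
  refine le_trans ?_ hd
  rw [← Subtype.val_injective.encard_image]
  have hsub : Subtype.val '' (treeGraph d n).neighborSet v ⊆
      insert v.1.tail ((fun a : Fin d => a :: v.1) '' Set.univ) := by
    rintro _ ⟨w, hw, rfl⟩
    rcases treeGraph_adj.1 hw with ⟨a, ha⟩ | ⟨a, ha⟩
    · exact Or.inl (by rw [ha, List.tail_cons])
    · exact Or.inr ⟨a, trivial, ha.symm⟩
  refine (Set.encard_le_encard hsub).trans ((Set.encard_insert_le _ _).trans ?_)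
  gcongr
  refine (Set.encard_image_le _ _).trans (le_of_eq ?_)
  simp

theorem length_le_of_walk {u w : TreeVertex d n} (p : (treeGraph d n).Walk u w) :
    w.1.length ≤ u.1.length + p.length := by
  induction p with
  | nil => simp
  | cons hadj p ih =>
    rw [SimpleGraph.Walk.length_cons]
    rcases treeGraph_adj.1 hadj with ⟨a, ha⟩ | ⟨a, ha⟩ <;>
    · have := congrArg List.length ha
      rw [List.length_cons] at this
      omega

open Classical in
theorem card_children {v : TreeVertex d n} (hv : v.1.length < n) (s : Finset (TreeVertex d n))
    (hs : ∀ u, u ∈ s ↔ ∃ a, u.1 = a :: v.1) : s.card = d := by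
  have : s = Finset.univ.image fun a : Fin d =>
      (⟨a :: v.1, by rw [List.length_cons]; omega⟩ : TreeVertex d n) := by
    ext u
    simp only [hs, Finset.mem_image, Finset.mem_univ, true_and]
    exact exists_congr fun a => ⟨fun h => Subtype.ext h.symm, fun h => by rw [← h]⟩
  rw [this, Finset.card_image_of_injective, Finset.card_univ, Fintype.card_fin]
  intro a b hab
  simpa using congrArg Subtype.val hab

open Classical in
/-- The leaves of the `d`-ary tree. -/
noncomputable def leaves (d n : ℕ) : Finset (TreeVertex d n) := {u | u.1.length = n}

theorem mem_leaves {u : TreeVertex d n} : u ∈ leaves d n ↔ u.1.length = n := by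
  simp [leaves]

theorem pinCount_leaves_of_lt (i : Fin 2) {v : TreeVertex d n} (hv : v.1.length + 1 < n) :
    pinCount (treeGraph d n) (leaves d n) (fun _ => i) v = 0 := by
  classical
  funext j
  refine Finset.card_eq_zero.2 (Finset.filter_eq_empty_iff.2 fun w hw hadj => ?_)
  have hw' := mem_leaves.1 hw
  rcases treeGraph_adj.1 hadj.1 with ⟨a, ha⟩ | ⟨a, ha⟩ <;>
  · have := congrArg List.length ha
    rw [List.length_cons] at this
    omega

theorem pinCount_leaves_of_eq (i : Fin 2) {v : TreeVertex d n} (hv : v.1.length + 1 = n)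
    (j : Fin 2) :
    pinCount (treeGraph d n) (leaves d n) (fun _ => i) v j = if i = j then d else 0 := by
  classical
  unfold pinCount
  split_ifs with hij
  · refine card_children (v := v) (by omega) _ fun u => ?_
    rw [Finset.mem_filter, mem_leaves, treeGraph_adj]
    constructor
    · rintro ⟨h1, h2 | ⟨a, ha⟩, -⟩
      · exact h2
      · have := congrArg List.length ha
        rw [List.length_cons] at this
        omega
    · rintro ⟨a, ha⟩
      exact ⟨by rw [ha, List.length_cons, hv], Or.inl ⟨a, ha⟩, hij⟩
  · exact Finset.card_eq_zero.2 (Finset.filter_eq_empty_iff.2 fun w _ h => hij h.2)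

variable {β γ lam : ℝ}

/-- The ratio at a vertex of height `k + 1` of the tree with all leaves pinned to `i`, after the
deletion of its parent, is the `k`-th iterate of the recursion. -/
theorem ratio_treeGraph [DecidableEq (TreeVertex d n)] (h : AntiFerromagnetic β γ lam) (i : Fin 2)
    (k : ℕ) :
    ∀ (W : Finset (TreeVertex d n)) (N : TreeVertex d n → Fin 2 → ℕ) (v : TreeVertex d n),
      v.1.length + (k + 1) = n → (∀ w ∈ W, w.1.length < n) →
      (∀ w, v.1 <:+ w.1 → w.1.length < n →
        w ∈ W ∧ N w = pinCount (treeGraph d n) (leaves d n) (fun _ => i) w) →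
      (∀ w a, v.1 = a :: w.1 → w ∉ W) →
      ratio β γ lam (treeGraph d n) W N v =
        (treeRec β γ lam d)^[k] (lam * (if i = 0 then β else 1 / γ) ^ d) := by
  classical
  induction k with
  | zero =>
    intro W N v hk hW hdesc hpar
    have hs : ∀ u, u ∈ (∅ : Finset (TreeVertex d n)) ↔
        u ∈ W.erase v ∧ (treeGraph d n).Adj v u := by
      intro u
      refine ⟨fun h => absurd h (Finset.notMem_empty u), fun ⟨hu, hadj⟩ => ?_⟩
      have huW := Finset.mem_of_mem_erase hu
      rcases treeGraph_adj.1 hadj with ⟨a, ha⟩ | ⟨a, ha⟩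
      · exact absurd huW (hpar u a ha)
      · have h1 := hW u huW
        have := congrArg List.length ha
        rw [List.length_cons] at this
        omega
    obtain ⟨M, hM, -, -⟩ := exists_ratio_eq_prod h (treeGraph d n) ∅ hs N N
    rw [hM, (hdesc v List.suffix_rfl (by omega)).2,
      pinCount_leaves_of_eq i (by omega), pinCount_leaves_of_eq i (by omega)]
    fin_cases i <;> simp
  | succ k ih =>
    intro W N v hk hW hdesc hpar
    set s : Finset (TreeVertex d n) := {u | ∃ a, u.1 = a :: v.1} with hsdef
    have hmem : ∀ u, u ∈ s ↔ ∃ a, u.1 = a :: v.1 := fun u => by simp [hsdef]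
    have hlen : ∀ u ∈ s, u.1.length = v.1.length + 1 := fun u hu => by
      obtain ⟨a, ha⟩ := (hmem u).1 hu
      rw [ha, List.length_cons]
    have hsuf : ∀ u ∈ s, v.1 <:+ u.1 := fun u hu => by
      obtain ⟨a, ha⟩ := (hmem u).1 hu
      rw [ha]
      exact List.suffix_cons a v.1
    have hs : ∀ u, u ∈ s ↔ u ∈ W.erase v ∧ (treeGraph d n).Adj v u := by
      intro u
      constructor
      · intro hu
        have hl := hlen u hu
        refine ⟨Finset.mem_erase.2 ⟨?_, (hdesc u (hsuf u hu) (by omega)).1⟩,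
          Or.inr ((hmem u).1 hu)⟩
        rintro rfl
        omega
      · rintro ⟨hu, hadj⟩
        rcases treeGraph_adj.1 hadj with ⟨a, ha⟩ | ha
        · exact absurd (Finset.mem_of_mem_erase hu) (hpar u a ha)
        · exact (hmem u).2 ha
    obtain ⟨M, hM, -, hMs⟩ := exists_ratio_eq_prod h (treeGraph d n) s hs N N
    have hchild : ∀ u ∈ s, edgeMap β γ (ratio β γ lam (treeGraph d n) (W.erase v) (N + M u) u) =
        edgeMap β γ
          ((treeRec β γ lam d)^[k] (lam * (if i = 0 then β else 1 / γ) ^ d)) := by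
      intro u hu
      have hl := hlen u hu
      obtain ⟨a, ha⟩ := (hmem u).1 hu
      congr 1
      refine ih (W.erase v) _ u (by omega) (fun w hw => hW w (Finset.mem_of_mem_erase hw))
        (fun w huw hw => ?_) fun w b hb hw => ?_
      · obtain ⟨h1, h2⟩ := hdesc w ((hsuf u hu).trans huw) hw
        refine ⟨Finset.mem_erase.2 ⟨?_, h1⟩, ?_⟩
        · rintro rfl
          have := huw.length_le
          omega
        · have hMw : M u w = 0 := by
            by_cases hwu : w = u
            · rw [hwu]
              exact (hMs u hu).1
            · have hws : w ∉ s := fun hws => hwu (Subtype.ext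
                (huw.eq_of_length (by rw [hl, hlen w hws])).symm)
              have := (hMs u hu).2 w
              rw [if_neg hws] at this
              funext j
              have h0 : M u w 0 = 0 := by omega
              have h1 : M u w 1 = 0 := by omega
              fin_cases j
              exacts [h0, h1]
          rw [Pi.add_apply, hMw, add_zero, h2]
      · have hwv : w = v := Subtype.ext (by
          rw [ha] at hb
          exact (List.cons.inj hb).2.symm)
        rw [hwv] at hw
        exact Finset.notMem_erase v W hw
    rw [hM, Finset.prod_congr rfl hchild, Finset.prod_const,
      card_children (v := v) (by omega) s hmem, (hdesc v List.suffix_rfl (by omega)).2,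
      pinCount_leaves_of_lt i (by omega), Function.iterate_succ_apply', treeRec_eq]
    simp

theorem feasible_leaves (h : AntiFerromagnetic β γ lam) (i : Fin 2) :
    Feasible β γ lam (treeGraph d n) (Λ := {u | u.1.length = n}) fun _ => i := by
  classical
  unfold Feasible
  rw [gibbsProb_eq]
  refine div_pos (Finset.sum_pos' (fun σ _ => weight_nonneg h _ σ)
    ⟨fun u => if u.1.length = n then i else 1, ?_, ?_⟩) (partitionFunction_pos h _)
  · simp only [Finset.mem_filter, Finset.mem_univ, true_and]
    exact fun u => if_pos u.2
  · refine mul_pos (Finset.prod_pos fun e he => ?_) (Finset.prod_pos fun v _ => field_pos h _)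
    induction e using Sym2.ind with
    | _ u w =>
      have hadj : (treeGraph d n).Adj u w := by simpa using he
      rw [edgeWeight_mk]
      -- adjacent vertices are not both leaves
      by_cases hw : w.1.length = n
      · have hu : u.1.length ≠ n := by
          rcases treeGraph_adj.1 hadj with ⟨a, ha⟩ | ⟨a, ha⟩ <;>
          · have := congrArg List.length ha
            rw [List.length_cons] at this
            omega
        rw [if_neg hu, interaction_symm]
        exact interaction_one_pos h _
      · rw [if_neg hw]
        exact interaction_one_pos h _

theorem marginal_treeGraph_root (h : AntiFerromagnetic β γ lam) (d k : ℕ) (i : Fin 2) :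
    marginal β γ lam (treeGraph d (k + 1)) (Λ := {u | u.1.length = k + 1}) (fun _ => i)
        ⟨[], by simp⟩ =
      (treeRec β γ lam d)^[k] (lam * (if i = 0 then β else 1 / γ) ^ d) /
        (1 + (treeRec β γ lam d)^[k] (lam * (if i = 0 then β else 1 / γ) ^ d)) := by
  classical
  rw [marginal_eq_ratio h (treeGraph d (k + 1)) (fun _ => i) (feasible_leaves h i)
    (B := leaves d (k + 1)) (W := Finset.univ \ leaves d (k + 1)) (fun u => mem_leaves)
    (fun u => by simp [mem_leaves]) (ρ := fun _ => i) (fun _ => rfl) (by simp)]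
  rw [ratio_treeGraph h i k]
  · simp
  · intro w hw
    have h1 := w.2
    have h2 : ¬ w.1.length = k + 1 := fun h => (Finset.mem_sdiff.1 hw).2 (mem_leaves.2 h)
    omega
  · exact fun w _ hw => ⟨Finset.mem_sdiff.2 ⟨Finset.mem_univ _, fun h =>
      hw.ne (mem_leaves.1 h)⟩, rfl⟩
  · intro w a ha
    simp at ha

theorem uniqueUpTo_of_strongSpatialMixing (h : AntiFerromagnetic β γ lam) {Δ : ℕ∞}
    (hssm : StrongSpatialMixing β γ lam (MaxDegreeAtMost Δ)) : UniqueUpTo β γ lam Δ := by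
  obtain ⟨C, -, α, hα, hmix⟩ := hssm
  intro d hd hdΔ
  refine uniqueOnRegularTree_of_exponential h hd (C := C) hα fun k => ?_
  have hdist : ((k + 1 : ℕ) : ℕ∞) ≤ distToSet (treeGraph d (k + 1)) ⟨[], by simp⟩
      (disagreement (Λ := {u : TreeVertex d (k + 1) | u.1.length = k + 1})
        (fun _ => 0) fun _ => 1) := by
    refine le_iInf₂ fun u hu => le_iInf fun p => ?_
    obtain ⟨hu, -⟩ := hu
    have h1 := length_le_of_walk p
    have h2 : u.1.length = k + 1 := hu
    rw [h2, List.length_nil, zero_add] at h1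
    exact_mod_cast h1
  have := hmix _ (treeGraph d (k + 1))
    (treeGraph_maxDegreeAtMost d (k + 1) (Order.add_one_le_of_lt hdΔ)) ⟨[], by simp⟩
    {u | u.1.length = k + 1} (fun _ => 0) (fun _ => 1) (feasible_leaves h 0)
    (feasible_leaves h 1) (k + 1) hdist
  rw [marginal_treeGraph_root h d k 0, marginal_treeGraph_root h d k 1] at this
  simpa using this

end

end TwoSpin

theorem theorem1 (β γ lam : ℝ) (hanti : TwoSpin.AntiFerromagnetic β γ lam)
    (Δ : ℕ∞) (hΔ : 2 ≤ Δ) :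
    TwoSpin.StrongSpatialMixing β γ lam (TwoSpin.MaxDegreeAtMost Δ) ↔
      TwoSpin.UniqueUpTo β γ lam Δ :=
  ⟨TwoSpin.uniqueUpTo_of_strongSpatialMixing hanti,
    TwoSpin.strongSpatialMixing_of_uniqueUpTo hanti⟩
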